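/- Let $n\ge 3$, $m\ge 1$, $r\ge 1$ be integers. Let $(\mathbb{R}^n,g)$ be pseudo-Euclidean space with coordinates $p=(p_1,\dots,p_n)$ and $g_{ij}=\delta_{ij}\varepsilon_i$, $\varepsilon_i=\pm1$, and let $\xi=\sum_{i=1}^n\alpha_ip_i$ with $\alpha_i\in\mathbb{R}$ and $\sum_{i=1}^n\varepsilon_i\alpha_i^2=\varepsilon_{i_0}$ for some index $i_0$. Let $(F^m,g_F)$ be a Ricci-flat semi-Riemannian manifold of dimension $m$. Let $k>0$, $c>0$, $a=(n-2)k-m$, $b=m(2k+1)-(n-2)k^2$, and $$v(z)=\frac{r(a-rz)}{r(r-1)z^2-2r(k+a)z+a^2-b}.$$ Let $J\subseteq\mathbb{R}$ be an open interval on which the denominator of $v$ has no zero, and let $V=\int v(z)\,dz$ be an antiderivative of $v$ on $J$. Let $K\subseteq\mathbb{R}$ be an open interval, let $z:K\to J$ be a non-constant smooth function and $x:K\to\mathbb{R}$ a function such that on $K$ $$v(z)\,z'-c\,(a-rz)\,e^{V(z)}=0,\qquad x=c\,e^{V(z)}.$$ Let $f,\varphi,h:K\to\mathbb{R}$ be differentiable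 functions, with $f>0$ and with $\varphi$ and $h$ nowhere zero, such that on $K$ $$\frac{f'}{f}=x,\qquad \frac{\varphi'}{\varphi}=k\,x,\qquad \frac{h'}{h}=x\,z.$$ Let $U=\{p\in\mathbb{R}^n:\xi(p)\in K\}$, and regard $f$, $\varphi$, $h$ as functions $f(\xi)$, $\varphi(\xi)$, $h(\xi)$ on $U$. Then the warped product $M=(U,\overline g)\times_fF^m$, with $\overline g=\frac1{\varphi^2}g$ and $\widetilde g=\overline g+f^2g_F$, together with $h$, is a quasi-Einstein semi-Riemannian manifold with $\rho=0$; that is, $\widetilde g$ is a semi-Riemannian metric on $M$, $h$ is smooth and nowhere zero on $M$, and $$\mathrm{Ric}_{\widetilde g}-\frac{r}{h}\,\mathrm{Hess}_{\widetilde g}h=0\quad\text{on }M.$$ -/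

import Mathlib

set_option maxSynthPendingDepth 3

open scoped Manifold ContDiff

noncomputable section

namespace SemiRiemannian

/-! ## Curvature in local coordinates

`E` is the coordinate space and `G : E → E →L[ℝ] E →L[ℝ] ℝ` is the metric written in coordinates;
`G y u v` is the product of the coordinate vectors `u` and `v` at the point `y`. -/

section Coordinates

variable {E : Type*} [NormedAddCommGroup E] [NormedSpace ℝ E]

/-- The covector `w ↦ ½ (∂_u G (v, w) + ∂_v G (u, w) - ∂_w G (u, v))` at `y`
(Christoffel symbols of the first kind), as a continuous bilinear function of `u` and `v`. -/
def christoffelFirst (G : E → E →L[ℝ] E →L[ℝ] ℝ) (y : E) : E →L[ℝ] E →L[ℝ] E →L[ℝ] ℝ :=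
  (1 / 2 : ℝ) •
    (fderiv ℝ G y + (fderiv ℝ G y).flip -
      ContinuousLinearMap.comp
        ((ContinuousLinearMap.flipₗᵢ ℝ E E ℝ).toContinuousLinearEquiv :
          (E →L[ℝ] E →L[ℝ] ℝ) →L[ℝ] (E →L[ℝ] E →L[ℝ] ℝ)) (fderiv ℝ G y).flip)

/-- The Christoffel symbols of the second kind: `christoffel G y u v` is the vector `Γ(u, v)` with
`G y (Γ(u, v)) w = ½ (∂_u G (v, w) + ∂_v G (u, w) - ∂_w G (u, v))` for all `w`; it is obtained by
applying the inverse of the isomorphism `G y : E → E*`. -/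
def christoffel (G : E → E →L[ℝ] E →L[ℝ] ℝ) (y : E) : E →L[ℝ] E →L[ℝ] E :=
  ContinuousLinearMap.compL ℝ E (E →L[ℝ] ℝ) E (G y).inverse ∘L christoffelFirst G y

/-- The endomorphism `u ↦ R(u, v) w` at `y`, where
`R(u, v) w = (∂_u Γ)(v, w) - (∂_v Γ)(u, w) + Γ(u, Γ(v, w)) - Γ(v, Γ(u, w))`. -/
def curvatureEnd (G : E → E →L[ℝ] E →L[ℝ] ℝ) (y v w : E) : E →L[ℝ] E :=
  ((fderiv ℝ (christoffel G) y).flip v).flip w - (fderiv ℝ (christoffel G) y v).flip w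
    + (christoffel G y).flip (christoffel G y v w)
    - christoffel G y v ∘L (christoffel G y).flip w

/-- The Ricci tensor in coordinates: `Ric(v, w) = tr (u ↦ R(u, v) w)`. -/
def ricciCoord (G : E → E →L[ℝ] E →L[ℝ] ℝ) (y v w : E) : ℝ :=
  LinearMap.trace ℝ E (curvatureEnd G y v w : E →ₗ[ℝ] E)

/-- The Hessian in coordinates: `Hess H (u, v) = D²H (u, v) - DH (Γ(u, v))`. -/
def hessCoord (G : E → E →L[ℝ] E →L[ℝ] ℝ) (H : E → ℝ) (y u v : E) : ℝ :=
  fderiv ℝ (fderiv ℝ H) y u v - fderiv ℝ H y (christoffel G y u v)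

end Coordinates

/-! ## Semi-Riemannian metrics, Ricci tensor and Hessian on a manifold without boundary -/

section Manifold

variable {E : Type*} [NormedAddCommGroup E] [NormedSpace ℝ E]
  {H : Type*} [TopologicalSpace H]
  {E' : Type*} [NormedAddCommGroup E'] [NormedSpace ℝ E']
  {H' : Type*} [TopologicalSpace H']

/-- Fields of bilinear forms on the tangent spaces of `M`. -/
abbrev BilinField (I : ModelWithCorners ℝ E H) (M : Type*) [TopologicalSpace M]
    [ChartedSpace H M] : Type _ :=
  ∀ x : M, TangentSpace I x →L[ℝ] TangentSpace I x →L[ℝ] ℝ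

/-- The pull-back `(T* g)_x (X, Y) = g_{T x} (dT_x X, dT_x Y)`. -/
def pullback (I : ModelWithCorners ℝ E H) {M : Type*} [TopologicalSpace M] [ChartedSpace H M]
    (I' : ModelWithCorners ℝ E' H') {N : Type*} [TopologicalSpace N] [ChartedSpace H' N]
    (T : M → N) (g : BilinField I' N) : BilinField I M := fun x =>
  (ContinuousLinearMap.precomp ℝ (mfderiv I I' T x)).comp
    ((g (T x)).comp (mfderiv I I' T x))

variable (I : ModelWithCorners ℝ E H) {M : Type*} [TopologicalSpace M] [ChartedSpace H M]

/-- The field `g` in the coordinates given by the preferred chart at `x₀`: its pull-back under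
the inverse of that chart. -/
def inChart (g : BilinField I M) (x₀ : M) : E → E →L[ℝ] E →L[ℝ] ℝ :=
  pullback 𝓘(ℝ, E) I (extChartAt I x₀).symm g

/-- `g` is a semi-Riemannian metric on the open set `S ⊆ M`: it is smooth in all
charts, symmetric, nondegenerate, and of constant signature (all tangent spaces have orthonormal
bases with one and the same family of signs `s`). -/
structure IsSemiRiemannianOn (g : BilinField I M) (S : Set M) : Prop where
  isOpen : IsOpen S
  smooth : ∀ x₀ : M, ContDiffOn ℝ ∞ (inChart I g x₀)
    ((extChartAt I x₀).target ∩ (extChartAt I x₀).symm ⁻¹' S)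
  symm : ∀ x ∈ S, ∀ X Y : TangentSpace I x, g x X Y = g x Y X
  nondegenerate : ∀ x ∈ S, ∀ X : TangentSpace I x, (∀ Y : TangentSpace I x, g x X Y = 0) → X = 0
  signature : ∃ (ι : Type) (s : ι → ℝ), (∀ i, s i = 1 ∨ s i = -1) ∧
    ∀ x ∈ S, ∃ e : Module.Basis ι ℝ (TangentSpace I x),
      (∀ i, g x (e i) (e i) = s i) ∧ ∀ i j, i ≠ j → g x (e i) (e j) = 0

/-- The Ricci tensor of `g` at `x`, computed in the chart at `x`. -/
def ricci (g : BilinField I M) (x : M) (X Y : TangentSpace I x) : ℝ :=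
  ricciCoord (inChart I g x) (extChartAt I x x)
    (mfderiv I 𝓘(ℝ, E) (extChartAt I x) x X) (mfderiv I 𝓘(ℝ, E) (extChartAt I x) x Y)

/-- The Hessian of `h` with respect to `g` at `x`, computed in the chart at `x`. -/
def hess (g : BilinField I M) (h : M → ℝ) (x : M) (X Y : TangentSpace I x) : ℝ :=
  hessCoord (inChart I g x) (h ∘ (extChartAt I x).symm) (extChartAt I x x)
    (mfderiv I 𝓘(ℝ, E) (extChartAt I x) x X) (mfderiv I 𝓘(ℝ, E) (extChartAt I x) x Y)

/-- The Ricci tensor of `g` vanishes. -/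
def IsRicciFlat (g : BilinField I M) : Prop :=
  ∀ (x : M) (X Y : TangentSpace I x), ricci I g x X Y = 0

/-- `(S, g, h)` is a quasi-Einstein semi-Riemannian manifold with parameters `r` and `ρ`:
`Ric_g - (r / h) Hess_g h = ρ g` on `S`, where `h` is smooth and has no zeros. -/
structure IsQuasiEinsteinOn (g : BilinField I M) (h : M → ℝ) (r ρ : ℝ) (S : Set M) : Prop where
  metric : IsSemiRiemannianOn I g S
  smooth : ContMDiffOn I 𝓘(ℝ) ∞ h S
  ne_zero : ∀ x ∈ S, h x ≠ 0
  equation : ∀ x ∈ S, ∀ X Y : TangentSpace I x,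
    ricci I g x X Y - r / h x * hess I g h x X Y = ρ * g x X Y

/-- The warped product metric `g_B + f² g_F` on `B × F`, with `f : B → ℝ`. -/
def warpedMetric (I' : ModelWithCorners ℝ E' H') {N : Type*} [TopologicalSpace N]
    [ChartedSpace H' N] (gB : BilinField I M) (f : M → ℝ) (gF : BilinField I' N) :
    BilinField (I.prod I') (M × N) := fun p =>
  pullback (I.prod I') I Prod.fst gB p + f p.1 ^ 2 • pullback (I.prod I') I' Prod.snd gF p

end Manifold

/-- The metric `g_{ij} = δ_{ij} ε_i` of the pseudo-Euclidean space `ℝⁿ`. -/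
def pseudoEuclidean {n : ℕ} (ε : Fin n → ℝ) :
    BilinField 𝓘(ℝ, EuclideanSpace ℝ (Fin n)) (EuclideanSpace ℝ (Fin n)) := fun _ =>
  ∑ i, ε i • ContinuousLinearMap.smulRight
    (EuclideanSpace.proj i : EuclideanSpace ℝ (Fin n) →L[ℝ] ℝ)
    (EuclideanSpace.proj i : EuclideanSpace ℝ (Fin n) →L[ℝ] ℝ)

/-- The conformal metric `(1 / φ²) g` on `ℝⁿ`, with `g` pseudo-Euclidean. -/
def conformalMetric {n : ℕ} (ε : Fin n → ℝ) (φ : EuclideanSpace ℝ (Fin n) → ℝ) :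
    BilinField 𝓘(ℝ, EuclideanSpace ℝ (Fin n)) (EuclideanSpace ℝ (Fin n)) := fun p =>
  (1 / φ p ^ 2) • pseudoEuclidean ε p

/-- The polynomial `r (r - 1) z² - 2 r (k + a) z + a² - b`. -/
def vDenom (r k a b z : ℝ) : ℝ := r * (r - 1) * z ^ 2 - 2 * r * (k + a) * z + a ^ 2 - b

/-- The function `v(z) = r (a - r z) / (r (r - 1) z² - 2 r (k + a) z + a² - b)`. -/
def vFun (r k a b z : ℝ) : ℝ := r * (a - r * z) / vDenom r k a b z

end SemiRiemannian

end

open scoped Topology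

noncomputable section

namespace SemiRiemannian

/-! ### Christoffel symbols, Ricci tensor and traces in a normed space. -/

section GeneralCoordinates

variable {E : Type*} [NormedAddCommGroup E] [NormedSpace ℝ E]

/-! Conformal factor, warping function and `h` depend on the base point only through the linear form
ξ, so the tensor equation reduces to ordinary differential equations. Let B be the flat form, N the
B-gradient of ξ, p = φ'/φ, q = f'/f and s = φ² f f'. The Koszul formula gives the Christoffel
symbols in closed form (`christoffel_warpedCoord`). Tracing the curvature and computing the Hessian
of h(ξ) shows that, up to the vanishing Ricci tensor of the fibre, both are combinations of the
three tensors ξ⊗ξ, ξ(N) B and ξ(N) g_F (`ricciCoord_of_christoffel_eq`,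
`hessCoord_of_christoffel_eq`). It is enough that the three coefficients cancel.

Put q = x, p = kx, h'/h = xz and x' = x²(a - rz). The coefficients of B and g_F then vanish because
a = (n-2)k - m, and that of ξ⊗ξ vanishes exactly when r z' = x D(z) (for x ≠ 0), where D is the
denominator of v (`ricciCoord_sub_hessCoord_warpedCoord`).

These two equations come from `hasDerivAt_of_vFun_equation`. Multiplying the given equation by D
yields (a - rz)(r z' - x D(z)) = 0. The first factor can be cancelled even where z = a/r, since z is
not constant and x D(z) has no zeros (`deriv_eq_of_deriv_eq_off_level`). Then x' = x v(z) z' = x²(a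
- rz).

What remains is regularity, obtained by bootstrapping the equations, and the passage from the
manifold to its charts, where the product chart is the identity times a chart of the fibre
(`inChart_warpedMetric`). -/

theorem christoffelFirst_apply (G : E → E →L[ℝ] E →L[ℝ] ℝ) (y u v w : E) :
    christoffelFirst G y u v w =
      1 / 2 * (fderiv ℝ G y u v w + fderiv ℝ G y v u w - fderiv ℝ G y w u v) := rfl

theorem christoffel_apply (G : E → E →L[ℝ] E →L[ℝ] ℝ) (y u v : E) :
    christoffel G y u v = (G y).inverse (christoffelFirst G y u v) := rfl

theorem curvatureEnd_apply (G : E → E →L[ℝ] E →L[ℝ] ℝ) (y v w u : E) :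
    curvatureEnd G y v w u =
      fderiv ℝ (christoffel G) y u v w - fderiv ℝ (christoffel G) y v u w
        + christoffel G y u (christoffel G y v w) - christoffel G y v (christoffel G y u w) := rfl

/-- The Christoffel symbols are characterised by the defining equation. -/
theorem christoffel_eq_of_forall {G : E → E →L[ℝ] E →L[ℝ] ℝ} {y : E} (hG : (G y).IsInvertible)
    {Γ : E →L[ℝ] E →L[ℝ] E}
    (h : ∀ u v w, G y (Γ u v) w = christoffelFirst G y u v w) : christoffel G y = Γ := by
  ext u v
  rw [christoffel_apply, hG.inverse_apply_eq]
  ext w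
  exact (h u v w).symm

theorem apply_christoffel {G : E → E →L[ℝ] E →L[ℝ] ℝ} {y : E} (hG : (G y).IsInvertible)
    (u v : E) : G y (christoffel G y u v) = christoffelFirst G y u v := by
  rw [christoffel_apply, hG.self_apply_inverse]

/-- An injective map between E and its dual is bijective by dimension. Invertibility has to be
supplied because `inverse` takes the value 0 on maps that are not invertible. -/
theorem isInvertible_of_nondegenerate [FiniteDimensional ℝ E] {B : E →L[ℝ] E →L[ℝ] ℝ}
    (hB : ∀ X, (∀ Y, B X Y = 0) → X = 0) : B.IsInvertible := by
  have hinj : Function.Injective B := by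
    rw [injective_iff_map_eq_zero]
    intro X hX
    exact hB X fun Y => by rw [hX]; rfl
  have hdim : Module.finrank ℝ E = Module.finrank ℝ (E →L[ℝ] ℝ) := by
    rw [← (LinearMap.toContinuousLinearMap (𝕜 := ℝ) (E := E) (F' := ℝ)).finrank_eq]
    exact Subspace.dual_finrank_eq.symm
  exact ⟨(LinearEquiv.ofInjectiveOfFinrankEq (B : E →ₗ[ℝ] E →L[ℝ] ℝ) hinj
    hdim).toContinuousLinearEquiv, by ext; rfl⟩

theorem fderiv_apply_symm {G : E → E →L[ℝ] E →L[ℝ] ℝ} {y : E}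
    (hs : ∀ᶠ y' in 𝓝 y, ∀ X Y, G y' X Y = G y' Y X) (u v w : E) :
    fderiv ℝ G y u v w = fderiv ℝ G y u w v := by
  by_cases hd : DifferentiableAt ℝ G y
  · have h1 : HasFDerivAt (fun y' => G y' v w) _ y :=
      (hd.hasFDerivAt.clm_apply (hasFDerivAt_const v y)).clm_apply (hasFDerivAt_const w y)
    have h2 : HasFDerivAt (fun y' => G y' w v) _ y :=
      (hd.hasFDerivAt.clm_apply (hasFDerivAt_const w y)).clm_apply (hasFDerivAt_const v y)
    have h3 := (h1.congr_of_eventuallyEq (hs.mono fun y' h => h w v)).unique h2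
    simpa using DFunLike.congr_fun h3 u
  -- Without differentiability `fderiv` is 0, so both sides vanish.
  · simp [fderiv_zero_of_not_differentiableAt hd]

/-- The Christoffel symbols of a symmetric field are symmetric. -/
theorem christoffel_symm {G : E → E →L[ℝ] E →L[ℝ] ℝ} {y : E}
    (hs : ∀ᶠ y' in 𝓝 y, ∀ X Y, G y' X Y = G y' Y X) (u v : E) :
    christoffel G y u v = christoffel G y v u := by
  rw [christoffel_apply, christoffel_apply]
  congr 1
  ext w
  rw [christoffelFirst_apply, christoffelFirst_apply, fderiv_apply_symm hs w u v]
  ring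

/-- The symbols of the first kind are linear in the derivative of G, and inversion of operators is
smooth near an invertible one. -/
theorem differentiableAt_christoffel [CompleteSpace E] {G : E → E →L[ℝ] E →L[ℝ] ℝ} {y : E}
    (hG : ContDiffAt ℝ 2 G y) (hi : (G y).IsInvertible) :
    DifferentiableAt ℝ (christoffel G) y := by
  have h1 : DifferentiableAt ℝ (fderiv ℝ G) y :=
    (hG.fderiv_right (m := 1) (by norm_num)).differentiableAt (by norm_num)
  have h2 : DifferentiableAt ℝ (christoffelFirst G) y := by
    have h3 : DifferentiableAt ℝ (fun y => (fderiv ℝ G y).flip) y :=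
      (ContinuousLinearMap.flipₗᵢ ℝ E E (E →L[ℝ] ℝ)).toContinuousLinearEquiv.differentiableAt.comp
        y h1
    have h4 : DifferentiableAt ℝ (fun y => ContinuousLinearMap.comp
        ((ContinuousLinearMap.flipₗᵢ ℝ E E ℝ).toContinuousLinearEquiv :
          (E →L[ℝ] E →L[ℝ] ℝ) →L[ℝ] (E →L[ℝ] E →L[ℝ] ℝ)) (fderiv ℝ G y).flip) y :=
      (differentiableAt_const _).clm_comp h3
    have h5 : DifferentiableAt ℝ (fun y => (1 / 2 : ℝ) • (fderiv ℝ G y + (fderiv ℝ G y).flip -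
        ContinuousLinearMap.comp
          ((ContinuousLinearMap.flipₗᵢ ℝ E E ℝ).toContinuousLinearEquiv :
            (E →L[ℝ] E →L[ℝ] ℝ) →L[ℝ] (E →L[ℝ] E →L[ℝ] ℝ)) (fderiv ℝ G y).flip)) y :=
      ((h1.add h3).sub h4).const_smul (1 / 2 : ℝ)
    exact h5
  have h3 : DifferentiableAt ℝ (fun y => (G y).inverse) y := by
    obtain ⟨e, he⟩ := hi
    have h4 : ContDiffAt ℝ 1 ContinuousLinearMap.inverse (G y) := he ▸ contDiffAt_map_inverse e
    exact (h4.differentiableAt (by norm_num)).comp y (hG.differentiableAt (by norm_num))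
  have h4 : DifferentiableAt ℝ
      (fun y => ContinuousLinearMap.compL ℝ E (E →L[ℝ] ℝ) E (G y).inverse) y :=
    (ContinuousLinearMap.compL ℝ E (E →L[ℝ] ℝ) E).differentiableAt.comp y h3
  exact h4.clm_comp h2

theorem ricciCoord_congr {G G' : E → E →L[ℝ] E →L[ℝ] ℝ} {y : E} (h : G =ᶠ[𝓝 y] G') (v w : E) :
    ricciCoord G y v w = ricciCoord G' y v w := by
  have h1 : christoffel G =ᶠ[𝓝 y] christoffel G' := by
    filter_upwards [h, h.fderiv (𝕜 := ℝ)] with y' h1 h2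
    rw [christoffel, christoffel, christoffelFirst, christoffelFirst, h1, h2]
  rw [ricciCoord, ricciCoord, curvatureEnd, curvatureEnd, h1.fderiv_eq, h1.eq_of_nhds]

theorem hessCoord_congr {G G' : E → E →L[ℝ] E →L[ℝ] ℝ} {y : E} (h : G =ᶠ[𝓝 y] G')
    {H H' : E → ℝ} (hH : H =ᶠ[𝓝 y] H') (v w : E) :
    hessCoord G H y v w = hessCoord G' H' y v w := by
  rw [hessCoord, hessCoord, christoffel, christoffel, christoffelFirst, christoffelFirst,
    h.fderiv_eq, h.eq_of_nhds, hH.fderiv_eq, hH.fderiv.fderiv_eq]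

/-- Cyclicity of the trace moves the projections to the right, and inl ∘ fst + inr ∘ snd is the
identity. This splits the Ricci trace into base and fibre directions. -/
theorem trace_prod_eq {E₁ E₂ : Type*} [NormedAddCommGroup E₁] [NormedSpace ℝ E₁]
    [NormedAddCommGroup E₂] [NormedSpace ℝ E₂] [FiniteDimensional ℝ E₁] [FiniteDimensional ℝ E₂]
    (T : E₁ × E₂ →ₗ[ℝ] E₁ × E₂) :
    LinearMap.trace ℝ _ T =
      LinearMap.trace ℝ _ (LinearMap.fst ℝ E₁ E₂ ∘ₗ T ∘ₗ LinearMap.inl ℝ E₁ E₂)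
        + LinearMap.trace ℝ _ (LinearMap.snd ℝ E₁ E₂ ∘ₗ T ∘ₗ LinearMap.inr ℝ E₁ E₂) := by
  rw [LinearMap.trace_comp_comm' (T ∘ₗ LinearMap.inl ℝ E₁ E₂) (LinearMap.fst ℝ E₁ E₂),
    LinearMap.trace_comp_comm' (T ∘ₗ LinearMap.inr ℝ E₁ E₂) (LinearMap.snd ℝ E₁ E₂), ← map_add]
  congr 1
  have h0 : T (0, 0) = 0 := map_zero T
  ext x <;> simp [h0]

end GeneralCoordinates

/-! ### Christoffel symbols of the warped product in coordinates. -/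

section WarpedCoordinates

variable {E₁ E₂ : Type*} [NormedAddCommGroup E₁] [NormedSpace ℝ E₁]
    [NormedAddCommGroup E₂] [NormedSpace ℝ E₂]

local notation "𝓔" => E₁ × E₂

variable (E₁ E₂) in
/-- Pull-back of bilinear forms under the first projection. -/
def baseForm (B : E₁ →L[ℝ] E₁ →L[ℝ] ℝ) : 𝓔 →L[ℝ] 𝓔 →L[ℝ] ℝ :=
  (ContinuousLinearMap.precomp ℝ (.fst ℝ E₁ E₂)).comp (B.comp (.fst ℝ E₁ E₂))

variable (E₁ E₂) in
/-- Pull-back of bilinear maps under the second projection, with values mapped by `T`. -/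
def fiberForm {X Y : Type*} [NormedAddCommGroup X] [NormedSpace ℝ X] [NormedAddCommGroup Y]
    [NormedSpace ℝ Y] (T : X →L[ℝ] Y) :
    (E₂ →L[ℝ] E₂ →L[ℝ] X) →L[ℝ] (𝓔 →L[ℝ] 𝓔 →L[ℝ] Y) :=
  (ContinuousLinearMap.precomp (𝓔 →L[ℝ] Y) (.snd ℝ E₁ E₂)).comp
    (ContinuousLinearMap.postcomp E₂
      ((ContinuousLinearMap.precomp Y (.snd ℝ E₁ E₂)).comp (ContinuousLinearMap.postcomp E₂ T)))

@[simp] theorem baseForm_apply (B : E₁ →L[ℝ] E₁ →L[ℝ] ℝ) (X Y : 𝓔) :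
    baseForm E₁ E₂ B X Y = B X.1 Y.1 := rfl

@[simp] theorem fiberForm_apply {X Y : Type*} [NormedAddCommGroup X] [NormedSpace ℝ X]
    [NormedAddCommGroup Y] [NormedSpace ℝ Y] (T : X →L[ℝ] Y) (g : E₂ →L[ℝ] E₂ →L[ℝ] X) (u v : 𝓔) :
    fiberForm E₁ E₂ T g u v = T (g u.2 v.2) := rfl

/-- The warped product metric `A(ξ) B + w(ξ) g_F` in coordinates. -/
def warpedCoord (ξ : E₁ →L[ℝ] ℝ) (B : E₁ →L[ℝ] E₁ →L[ℝ] ℝ) (GF : E₂ → E₂ →L[ℝ] E₂ →L[ℝ] ℝ)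
    (A w : ℝ → ℝ) (y : 𝓔) : 𝓔 →L[ℝ] 𝓔 →L[ℝ] ℝ :=
  A (ξ y.1) • baseForm E₁ E₂ B + w (ξ y.1) • fiberForm E₁ E₂ (.id ℝ ℝ) (GF y.2)

@[simp] theorem warpedCoord_apply (ξ : E₁ →L[ℝ] ℝ) (B : E₁ →L[ℝ] E₁ →L[ℝ] ℝ)
    (GF : E₂ → E₂ →L[ℝ] E₂ →L[ℝ] ℝ) (A w : ℝ → ℝ) (y X Y : 𝓔) :
    warpedCoord ξ B GF A w y X Y =
      A (ξ y.1) * B X.1 Y.1 + w (ξ y.1) * GF y.2 X.2 Y.2 := rfl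

/-- The map `(X, Y) ↦ (ξ(X) Y + ξ(Y) X - B(X, Y) N, 0)`. -/
def conformalPart (ξ : E₁ →L[ℝ] ℝ) (B : E₁ →L[ℝ] E₁ →L[ℝ] ℝ) (N : E₁) :
    𝓔 →L[ℝ] 𝓔 →L[ℝ] 𝓔 :=
  (ContinuousLinearMap.postcomp 𝓔 (.inl ℝ E₁ E₂)).comp
    ((ξ.comp (.fst ℝ E₁ E₂)).smulRight (.fst ℝ E₁ E₂)
      + ((ξ.comp (.fst ℝ E₁ E₂)).smulRight (.fst ℝ E₁ E₂)).flip
      - (ContinuousLinearMap.postcomp 𝓔 (.toSpanSingleton ℝ N)).comp (baseForm E₁ E₂ B))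

/-- The map `(X, Y) ↦ (0, ξ(X) Y + ξ(Y) X)`. -/
def mixedPart (ξ : E₁ →L[ℝ] ℝ) : 𝓔 →L[ℝ] 𝓔 →L[ℝ] 𝓔 :=
  (ContinuousLinearMap.postcomp 𝓔 (.inr ℝ E₁ E₂)).comp
    ((ξ.comp (.fst ℝ E₁ E₂)).smulRight (.snd ℝ E₁ E₂)
      + ((ξ.comp (.fst ℝ E₁ E₂)).smulRight (.snd ℝ E₁ E₂)).flip)

@[simp] theorem conformalPart_apply (ξ : E₁ →L[ℝ] ℝ) (B : E₁ →L[ℝ] E₁ →L[ℝ] ℝ) (N : E₁)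
    (X Y : 𝓔) : conformalPart ξ B N X Y =
      (ξ X.1 • Y.1 + ξ Y.1 • X.1 - B X.1 Y.1 • N, 0) := rfl

@[simp] theorem mixedPart_apply (ξ : E₁ →L[ℝ] ℝ) (X Y : 𝓔) :
    mixedPart ξ X Y = (0, ξ X.1 • Y.2 + ξ Y.1 • X.2) := rfl

/-- The Christoffel symbols of the warped product metric. -/
def warpedChristoffel (ξ : E₁ →L[ℝ] ℝ) (B : E₁ →L[ℝ] E₁ →L[ℝ] ℝ) (N : E₁)
    (GF : E₂ → E₂ →L[ℝ] E₂ →L[ℝ] ℝ) (p q s : ℝ → ℝ) (y : 𝓔) : 𝓔 →L[ℝ] 𝓔 →L[ℝ] 𝓔 :=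
  q (ξ y.1) • mixedPart ξ - p (ξ y.1) • conformalPart ξ B N
    - s (ξ y.1) • fiberForm E₁ E₂ (.toSpanSingleton ℝ (N, 0)) (GF y.2)
    + fiberForm E₁ E₂ (.inr ℝ E₁ E₂) (christoffel GF y.2)

theorem warpedChristoffel_apply (ξ : E₁ →L[ℝ] ℝ) (B : E₁ →L[ℝ] E₁ →L[ℝ] ℝ) (N : E₁)
    (GF : E₂ → E₂ →L[ℝ] E₂ →L[ℝ] ℝ) (p q s : ℝ → ℝ) (y X Y : 𝓔) :
    warpedChristoffel ξ B N GF p q s y X Y =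
      (-(p (ξ y.1) • (ξ X.1 • Y.1 + ξ Y.1 • X.1 - B X.1 Y.1 • N))
          - (s (ξ y.1) * GF y.2 X.2 Y.2) • N,
        q (ξ y.1) • (ξ X.1 • Y.2 + ξ Y.1 • X.2) + christoffel GF y.2 X.2 Y.2) := by
  ext <;> simp [warpedChristoffel, mul_smul]

variable {ξ : E₁ →L[ℝ] ℝ} {B : E₁ →L[ℝ] E₁ →L[ℝ] ℝ} {N : E₁}
  {GF : E₂ → E₂ →L[ℝ] E₂ →L[ℝ] ℝ} {A w p q s : ℝ → ℝ}

theorem fderiv_warpedCoord {y : 𝓔} {A' w' : ℝ} (hA : HasDerivAt A A' (ξ y.1))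
    (hw : HasDerivAt w w' (ξ y.1)) (hGF : DifferentiableAt ℝ GF y.2) (U X Y : 𝓔) :
    fderiv ℝ (warpedCoord ξ B GF A w) y U X Y =
      A' * ξ U.1 * B X.1 Y.1 + w' * ξ U.1 * GF y.2 X.2 Y.2
        + w (ξ y.1) * fderiv ℝ GF y.2 U.2 X.2 Y.2 := by
  have hξ : HasFDerivAt (fun y : 𝓔 => ξ y.1) (ξ.comp (.fst ℝ E₁ E₂)) y :=
    (ξ.comp (.fst ℝ E₁ E₂)).hasFDerivAt
  have h1 := (hA.comp_hasFDerivAt y hξ).smul_const (baseForm E₁ E₂ B)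
  have h2 : HasFDerivAt (fun y : 𝓔 => fiberForm E₁ E₂ (.id ℝ ℝ) (GF y.2)) _ y :=
    (fiberForm E₁ E₂ (.id ℝ ℝ)).hasFDerivAt.comp y (hGF.hasFDerivAt.comp y hasFDerivAt_snd)
  have h3 := (hw.comp_hasFDerivAt y hξ).smul h2
  have h4 : HasFDerivAt (warpedCoord ξ B GF A w) _ y := h1.add h3
  rw [h4.fderiv]
  simp
  ring

theorem fderiv_warpedChristoffel {y : 𝓔} {p' q' s' : ℝ} (hp : HasDerivAt p p' (ξ y.1))
    (hq : HasDerivAt q q' (ξ y.1)) (hs : HasDerivAt s s' (ξ y.1))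
    (hGF : DifferentiableAt ℝ GF y.2) (hΓ : DifferentiableAt ℝ (christoffel GF) y.2)
    (U X Y : 𝓔) :
    fderiv ℝ (warpedChristoffel ξ B N GF p q s) y U X Y =
      (-((p' * ξ U.1) • (ξ X.1 • Y.1 + ξ Y.1 • X.1 - B X.1 Y.1 • N))
          - (s' * ξ U.1 * GF y.2 X.2 Y.2 + s (ξ y.1) * fderiv ℝ GF y.2 U.2 X.2 Y.2) • N,
        (q' * ξ U.1) • (ξ X.1 • Y.2 + ξ Y.1 • X.2)
          + fderiv ℝ (christoffel GF) y.2 U.2 X.2 Y.2) := by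
  have hξ : HasFDerivAt (fun y : 𝓔 => ξ y.1) (ξ.comp (.fst ℝ E₁ E₂)) y :=
    (ξ.comp (.fst ℝ E₁ E₂)).hasFDerivAt
  have h1 := (hq.comp_hasFDerivAt y hξ).smul_const (mixedPart (E₂ := E₂) ξ)
  have h2 := (hp.comp_hasFDerivAt y hξ).smul_const (conformalPart (E₂ := E₂) ξ B N)
  have h3 : HasFDerivAt
      (fun y : 𝓔 => fiberForm E₁ E₂ (.toSpanSingleton ℝ ((N, 0) : 𝓔)) (GF y.2)) _ y :=
    (fiberForm E₁ E₂ (.toSpanSingleton ℝ ((N, 0) : 𝓔))).hasFDerivAt.comp y (hGF.hasFDerivAt.comp y hasFDerivAt_snd)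
  have h4 := (hs.comp_hasFDerivAt y hξ).smul h3
  have h5 : HasFDerivAt (fun y : 𝓔 => fiberForm E₁ E₂ (.inr ℝ E₁ E₂) (christoffel GF y.2)) _ y :=
    (fiberForm E₁ E₂ (.inr ℝ E₁ E₂)).hasFDerivAt.comp y (hΓ.hasFDerivAt.comp y hasFDerivAt_snd)
  have h6 : HasFDerivAt (warpedChristoffel ξ B N GF p q s) _ y := ((h1.sub h2).sub h4).add h5
  rw [h6.fderiv]
  ext
  · simp
    module
  · simp

/-- The Christoffel symbols of a warped product metric whose base is conformal to a constant
metric `B`, with conformal factor and warping function depending on the linear form `ξ` only. -/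
theorem christoffel_warpedCoord {y : 𝓔} (hN : ∀ X, B N X = ξ X)
    (hA : HasDerivAt A (-2 * p (ξ y.1) * A (ξ y.1)) (ξ y.1))
    (hw : HasDerivAt w (2 * q (ξ y.1) * w (ξ y.1)) (ξ y.1))
    (hs : s (ξ y.1) * A (ξ y.1) = q (ξ y.1) * w (ξ y.1))
    (hGF : DifferentiableAt ℝ GF y.2) (hGFi : (GF y.2).IsInvertible)
    (hi : (warpedCoord ξ B GF A w y).IsInvertible) :
    christoffel (warpedCoord ξ B GF A w) y = warpedChristoffel ξ B N GF p q s y := by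
  refine christoffel_eq_of_forall hi fun X Y Z => ?_
  rw [christoffelFirst_apply, fderiv_warpedCoord hA hw hGF, fderiv_warpedCoord hA hw hGF,
    fderiv_warpedCoord hA hw hGF, warpedChristoffel_apply, warpedCoord_apply]
  -- The purely fibrewise part of the Koszul formula is the Koszul formula of the fibre metric.
  have h := DFunLike.congr_fun (apply_christoffel hGFi X.2 Y.2) Z.2
  rw [christoffelFirst_apply] at h
  simp only [map_add, map_sub, map_neg, map_smul, add_apply,
    sub_apply, neg_apply, smul_apply,
    smul_eq_mul, hN, h]
  -- The only terms not yet matched are those in g_F(X, Y) ξ(Z); `hs` is the choice of s that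
  -- balances them.
  linear_combination (- GF y.2 X.2 Y.2 * ξ Z.1) * hs

end WarpedCoordinates

/-! ### Ricci tensor and Hessian of the warped product. -/

section WarpedCurvature

variable {E₁ E₂ : Type*} [NormedAddCommGroup E₁] [NormedSpace ℝ E₁]
    [NormedAddCommGroup E₂] [NormedSpace ℝ E₂]
  {ξ : E₁ →L[ℝ] ℝ} {B : E₁ →L[ℝ] E₁ →L[ℝ] ℝ} {N : E₁}
  {GF : E₂ → E₂ →L[ℝ] E₂ →L[ℝ] ℝ} {A w p q s : ℝ → ℝ}

local notation "𝓔" => E₁ × E₂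

/-- The trace over the base directions of the curvature of a warped product. -/
theorem trace_base_curvatureEnd [FiniteDimensional ℝ E₁]
    {G : 𝓔 → 𝓔 →L[ℝ] 𝓔 →L[ℝ] ℝ} {y : 𝓔}
    (hG : christoffel G =ᶠ[𝓝 y] warpedChristoffel ξ B N GF p q s)
    (hB : ∀ X Y, B X Y = B Y X) (hN : ∀ X, B N X = ξ X)
    {p' q' s' : ℝ} (hp : HasDerivAt p p' (ξ y.1))
    (hq : HasDerivAt q q' (ξ y.1)) (hs : HasDerivAt s s' (ξ y.1))
    (hGF : DifferentiableAt ℝ GF y.2) (hΓ : DifferentiableAt ℝ (christoffel GF) y.2)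
    (V W : 𝓔) :
    LinearMap.trace ℝ _ (LinearMap.fst ℝ E₁ E₂ ∘ₗ
        (curvatureEnd G y V W : 𝓔 →ₗ[ℝ] 𝓔) ∘ₗ LinearMap.inl ℝ E₁ E₂) =
      (Module.finrank ℝ E₁ - 2) * (p' + p (ξ y.1) ^ 2) * (ξ V.1 * ξ W.1)
        + (p' - (Module.finrank ℝ E₁ - 2) * p (ξ y.1) ^ 2) * ξ N * B V.1 W.1
        + (-s' + q (ξ y.1) * s (ξ y.1) + Module.finrank ℝ E₁ * p (ξ y.1) * s (ξ y.1))
          * ξ N * GF y.2 V.2 W.2 := by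
  have hN' : ∀ X, B X N = ξ X := fun X => by rw [hB, hN]
  set P := p (ξ y.1) with hP
  set Q := q (ξ y.1) with hQ
  set S := s (ξ y.1) with hS
  set γ := GF y.2 V.2 W.2 with hγ
  set β := B V.1 W.1 with hβ
  -- Z is the base component of Γ(V, W).
  set Z : E₁ := -(P • (ξ V.1 • W.1 + ξ W.1 • V.1 - β • N)) - (S * γ) • N with hZ
  -- As a function of U the curvature is a multiple of the identity plus rank-one maps, whose traces
  -- are read off as the covector applied to the vector.
  have key : LinearMap.fst ℝ E₁ E₂ ∘ₗ
        (curvatureEnd G y V W : 𝓔 →ₗ[ℝ] 𝓔) ∘ₗ LinearMap.inl ℝ E₁ E₂ =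
      (p' * ξ V.1 * ξ W.1 - P * ξ Z - P ^ 2 * ξ V.1 * ξ W.1) • LinearMap.id
      + (ξ : E₁ →ₗ[ℝ] ℝ).smulRight
        ((-p') • (ξ V.1 • W.1 + ξ W.1 • V.1 - β • N) - (s' * γ) • N + (p' * ξ V.1) • W.1
          - P • Z - (P ^ 2 * ξ V.1) • W.1 - (2 * P ^ 2 * ξ W.1) • V.1 + (P ^ 2 * β) • N
          + (S * Q * γ) • N)
      + (B W.1 : E₁ →ₗ[ℝ] ℝ).smulRight
        ((-p' * ξ V.1) • N + (P ^ 2 * ξ N) • V.1)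
      + (B Z : E₁ →ₗ[ℝ] ℝ).smulRight (P • N)
      + (B V.1 : E₁ →ₗ[ℝ] ℝ).smulRight ((P ^ 2 * ξ W.1) • N) := by
    ext U
    have h1 : (LinearMap.fst ℝ E₁ E₂ ∘ₗ
        (curvatureEnd G y V W : 𝓔 →ₗ[ℝ] 𝓔) ∘ₗ LinearMap.inl ℝ E₁ E₂) U =
        (curvatureEnd G y V W (U, 0)).1 := rfl
    rw [h1, curvatureEnd_apply, hG.fderiv_eq, hG.eq_of_nhds,
      fderiv_warpedChristoffel hp hq hs hGF hΓ, fderiv_warpedChristoffel hp hq hs hGF hΓ]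
    simp only [warpedChristoffel_apply, Prod.fst_add, Prod.fst_sub,
      map_zero, zero_apply, mul_zero, zero_mul, smul_zero, add_zero, sub_zero,
      ← hP, ← hQ, ← hS, ← hγ, ← hβ, ← hZ, map_add, map_sub, map_neg, map_smul, smul_eq_mul,
      LinearMap.add_apply, LinearMap.smul_apply, LinearMap.smulRight_apply, LinearMap.id_apply,
      ContinuousLinearMap.coe_coe, hN', hB U]
    module
  rw [key]
  simp only [map_add, map_smul, LinearMap.trace_id, LinearMap.trace_smulRight, smul_eq_mul,
    ContinuousLinearMap.coe_coe, map_sub, map_neg, hN', hB W.1 V.1, ← hβ, hZ, sub_apply,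
    add_apply, neg_apply, smul_apply]
  ring

/-- The trace over the fibre directions of the curvature of a warped product. -/
theorem trace_fiber_curvatureEnd [FiniteDimensional ℝ E₂]
    {G : 𝓔 → 𝓔 →L[ℝ] 𝓔 →L[ℝ] ℝ} {y : 𝓔}
    (hG : christoffel G =ᶠ[𝓝 y] warpedChristoffel ξ B N GF p q s)
    (hGFs : ∀ᶠ v in 𝓝 y.2, ∀ X Y, GF v X Y = GF v Y X)
    {p' q' s' : ℝ} (hp : HasDerivAt p p' (ξ y.1))
    (hq : HasDerivAt q q' (ξ y.1)) (hs : HasDerivAt s s' (ξ y.1))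
    (hGF : DifferentiableAt ℝ GF y.2) (hΓ : DifferentiableAt ℝ (christoffel GF) y.2)
    (V W : 𝓔) :
    LinearMap.trace ℝ _ (LinearMap.snd ℝ E₁ E₂ ∘ₗ
        (curvatureEnd G y V W : 𝓔 →ₗ[ℝ] 𝓔) ∘ₗ LinearMap.inr ℝ E₁ E₂) =
      ricciCoord GF y.2 V.2 W.2
        - Module.finrank ℝ E₂ * (q' + q (ξ y.1) ^ 2 + 2 * p (ξ y.1) * q (ξ y.1))
          * (ξ V.1 * ξ W.1)
        + Module.finrank ℝ E₂ * p (ξ y.1) * q (ξ y.1) * ξ N * B V.1 W.1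
        - (Module.finrank ℝ E₂ - 1) * q (ξ y.1) * s (ξ y.1) * ξ N * GF y.2 V.2 W.2 := by
  set P := p (ξ y.1) with hP
  set Q := q (ξ y.1) with hQ
  set S := s (ξ y.1) with hS
  set γ := GF y.2 V.2 W.2 with hγ
  set β := B V.1 W.1 with hβ
  set Z : E₁ := -(P • (ξ V.1 • W.1 + ξ W.1 • V.1 - β • N)) - (S * γ) • N with hZ
  -- Here the remainder is the curvature of the fibre, a multiple of the identity and a single
  -- rank-one map. The mixed terms in Γ_F(U, V) cancel by the symmetry of Γ_F.
  have key : LinearMap.snd ℝ E₁ E₂ ∘ₗ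
        (curvatureEnd G y V W : 𝓔 →ₗ[ℝ] 𝓔) ∘ₗ LinearMap.inr ℝ E₁ E₂ =
      (curvatureEnd GF y.2 V.2 W.2 : E₂ →ₗ[ℝ] E₂)
      + (Q * ξ Z - q' * ξ V.1 * ξ W.1 - Q ^ 2 * ξ V.1 * ξ W.1) • LinearMap.id
      + (GF y.2 W.2 : E₂ →ₗ[ℝ] ℝ).smulRight ((Q * S * ξ N) • V.2) := by
    ext U
    have h1 : (LinearMap.snd ℝ E₁ E₂ ∘ₗ
        (curvatureEnd G y V W : 𝓔 →ₗ[ℝ] 𝓔) ∘ₗ LinearMap.inr ℝ E₁ E₂) U =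
        (curvatureEnd G y V W (0, U)).2 := rfl
    rw [h1, curvatureEnd_apply, hG.fderiv_eq, hG.eq_of_nhds,
      fderiv_warpedChristoffel hp hq hs hGF hΓ, fderiv_warpedChristoffel hp hq hs hGF hΓ]
    simp only [warpedChristoffel_apply, Prod.snd_add, Prod.snd_sub,
      map_zero, zero_apply, mul_zero, zero_mul, smul_zero, add_zero, sub_zero, zero_smul, zero_add,
      zero_sub, neg_zero,
      ← hP, ← hQ, ← hS, ← hγ, ← hβ, ← hZ, map_add, map_neg, map_smul, smul_eq_mul,
      LinearMap.add_apply, LinearMap.smul_apply, LinearMap.smulRight_apply, LinearMap.id_apply,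
      ContinuousLinearMap.coe_coe, curvatureEnd_apply, christoffel_symm hGFs U V.2,
      hGFs.self_of_nhds U W.2]
    module
  rw [key]
  simp only [map_add, map_smul, LinearMap.trace_id, LinearMap.trace_smulRight, smul_eq_mul,
    ContinuousLinearMap.coe_coe, map_sub, map_neg, hGFs.self_of_nhds W.2 V.2, ← hγ, hZ, ricciCoord]
  ring

/-- The Ricci tensor of a warped product over a conformal base. -/
theorem ricciCoord_of_christoffel_eq [FiniteDimensional ℝ E₁] [FiniteDimensional ℝ E₂]
    {G : 𝓔 → 𝓔 →L[ℝ] 𝓔 →L[ℝ] ℝ} {y : 𝓔}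
    (hG : christoffel G =ᶠ[𝓝 y] warpedChristoffel ξ B N GF p q s)
    (hB : ∀ X Y, B X Y = B Y X) (hN : ∀ X, B N X = ξ X)
    (hGFs : ∀ᶠ v in 𝓝 y.2, ∀ X Y, GF v X Y = GF v Y X)
    {p' q' s' : ℝ} (hp : HasDerivAt p p' (ξ y.1))
    (hq : HasDerivAt q q' (ξ y.1)) (hs : HasDerivAt s s' (ξ y.1))
    (hGF : DifferentiableAt ℝ GF y.2) (hΓ : DifferentiableAt ℝ (christoffel GF) y.2)
    (V W : 𝓔) :
    ricciCoord G y V W = ricciCoord GF y.2 V.2 W.2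
      + ((Module.finrank ℝ E₁ - 2) * (p' + p (ξ y.1) ^ 2)
          - Module.finrank ℝ E₂ * (q' + q (ξ y.1) ^ 2 + 2 * p (ξ y.1) * q (ξ y.1)))
        * (ξ V.1 * ξ W.1)
      + (p' - (Module.finrank ℝ E₁ - 2) * p (ξ y.1) ^ 2
          + Module.finrank ℝ E₂ * p (ξ y.1) * q (ξ y.1)) * ξ N * B V.1 W.1
      - (s' - Module.finrank ℝ E₁ * p (ξ y.1) * s (ξ y.1)
          + (Module.finrank ℝ E₂ - 2) * q (ξ y.1) * s (ξ y.1)) * ξ N * GF y.2 V.2 W.2 := by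
  rw [ricciCoord, trace_prod_eq, trace_base_curvatureEnd hG hB hN hp hq hs hGF hΓ,
    trace_fiber_curvatureEnd hG hGFs hp hq hs hGF hΓ]
  ring

/-- The Hessian of a function of `ξ` on a warped product over a conformal base. -/
theorem hessCoord_of_christoffel_eq {G : 𝓔 → 𝓔 →L[ℝ] 𝓔 →L[ℝ] ℝ} {y : 𝓔}
    (hG : christoffel G y = warpedChristoffel ξ B N GF p q s y)
    {h h₁ : ℝ → ℝ} {h₂ : ℝ} (hh : ∀ᶠ t in 𝓝 (ξ y.1), HasDerivAt h (h₁ t) t)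
    (hh₁ : HasDerivAt h₁ h₂ (ξ y.1)) (V W : 𝓔) :
    hessCoord G (fun y => h (ξ y.1)) y V W =
      (h₂ + 2 * p (ξ y.1) * h₁ (ξ y.1)) * (ξ V.1 * ξ W.1)
        - h₁ (ξ y.1) * p (ξ y.1) * ξ N * B V.1 W.1
        + h₁ (ξ y.1) * s (ξ y.1) * ξ N * GF y.2 V.2 W.2 := by
  have hξ : ∀ y : 𝓔, HasFDerivAt (fun y : 𝓔 => ξ y.1) (ξ.comp (.fst ℝ E₁ E₂)) y := fun y =>
    (ξ.comp (.fst ℝ E₁ E₂)).hasFDerivAt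
  have h1 : ∀ᶠ y' in 𝓝 y, fderiv ℝ (fun y : 𝓔 => h (ξ y.1)) y' =
      h₁ (ξ y'.1) • ξ.comp (.fst ℝ E₁ E₂) := by
    filter_upwards [(hξ y).continuousAt.eventually hh] with y' hy'
    exact (hy'.comp_hasFDerivAt y' (hξ y')).fderiv
  have h2 : HasFDerivAt (fun y : 𝓔 => h₁ (ξ y.1) • ξ.comp (.fst ℝ E₁ E₂)) _ y :=
    (hh₁.comp_hasFDerivAt y (hξ y)).smul_const (ξ.comp (.fst ℝ E₁ E₂))
  rw [hessCoord, Filter.EventuallyEq.fderiv_eq h1, h2.fderiv, h1.self_of_nhds, hG,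
    warpedChristoffel_apply]
  simp
  ring

end WarpedCurvature

/-! ### The ordinary differential equations for z and x, and regularity. -/

section ScalarEquations

/-- If `z` is not constant and `z' = g` off a level set of `z`, with `g` continuous and without
zeros, then the level set has no interior and `z' = g` everywhere. -/
theorem deriv_eq_of_deriv_eq_off_level {K : Set ℝ} (hKo : IsOpen K) (hKc : K.OrdConnected)
    {z g : ℝ → ℝ} (hz : ContDiffOn ℝ 1 z K) (hg : ContinuousOn g K) (hg0 : ∀ t ∈ K, g t ≠ 0)
    (hz_nonconst : ∃ s ∈ K, ∃ t ∈ K, z s ≠ z t) {l : ℝ}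
    (h : ∀ t ∈ K, z t ≠ l → deriv z t = g t) {t : ℝ} (ht : t ∈ K) : deriv z t = g t := by
  have hdc : ContinuousOn (deriv z) K := hz.continuousOn_deriv_of_isOpen hKo le_rfl
  -- The equation is a closed condition, z' and g being continuous.
  have hcl : ∀ u ∈ K, u ∈ closure {v | v ∈ K ∧ z v ≠ l} → deriv z u = g u := by
    intro u hu huc
    have hmem : (deriv z - g) u ∈ closure ({0} : Set ℝ) := by
      refine ContinuousWithinAt.mem_closure
        (((hdc.sub hg).continuousAt (hKo.mem_nhds hu)).continuousWithinAt
          (s := {v | v ∈ K ∧ z v ≠ l})) huc ?_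
      rintro v ⟨hv, hvl⟩
      simp [h v hv hvl]
    simpa [sub_eq_zero] using hmem
  by_contra hne
  -- Inside K this is the interior of the level set, where z is locally constant; a failure of the
  -- equation makes it nonempty.
  set S : Set ℝ := (closure {v | v ∈ K ∧ z v ≠ l})ᶜ with hS
  have hSo : IsOpen S := isClosed_closure.isOpen_compl
  have htS : t ∈ S := fun hc => hne (hcl t ht hc)
  have hSl : ∀ u ∈ K ∩ S, z u = l := by
    rintro u ⟨hu, huS⟩
    by_contra hul
    exact huS (subset_closure ⟨hu, hul⟩)
  have hSd : ∀ u ∈ K ∩ S, deriv z u = 0 := by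
    intro u hu
    have h1 : z =ᶠ[𝓝 u] fun _ => l := by
      filter_upwards [(hKo.inter hSo).mem_nhds hu] with v hv using hSl v hv
    rw [h1.deriv_eq, deriv_const]
  -- K ∩ S is also closed in K: at a boundary point continuity gives z' = 0, while `hcl` gives z' =
  -- g ≠ 0. Connectedness then makes z constant on K.
  have hKS : K ⊆ S := by
    refine hKc.isPreconnected.subset_of_closure_inter_subset hSo ⟨t, ht, htS⟩ ?_
    rintro u ⟨hu, huK⟩
    by_contra huS
    have h1 : deriv z u = g u := hcl u huK (not_not.1 huS)
    have h2 : u ∈ closure (K ∩ S) :=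
      hKo.inter_closure ⟨huK, hu⟩
    have h3 : deriv z u ∈ closure ({0} : Set ℝ) :=
      ContinuousWithinAt.mem_closure
        ((hdc.continuousAt (hKo.mem_nhds huK)).continuousWithinAt) h2 fun v hv => hSd v hv
    rw [closure_singleton, h1] at h3
    exact hg0 u huK h3
  obtain ⟨u, hu, v, hv, huv⟩ := hz_nonconst
  exact huv ((hSl u ⟨hu, hKS hu⟩).trans (hSl v ⟨hv, hKS hv⟩).symm)

/-- One bootstrap step: the product gf is as smooth as its factors, so f gains one derivative. -/
theorem contDiffOn_succ_of_deriv_eq_mul {K : Set ℝ} (hKo : IsOpen K) {f g : ℝ → ℝ} {n : ℕ}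
    (hf : ContDiffOn ℝ n f K) (hg : ContDiffOn ℝ n g K)
    (h : ∀ t ∈ K, HasDerivAt f (g t * f t) t) : ContDiffOn ℝ (n + 1 : ℕ) f K := by
  have h1 : ContDiffOn ℝ ((n : ℕ∞ω) + 1) f K := by
    rw [contDiffOn_succ_iff_deriv_of_isOpen hKo]
    refine ⟨fun t ht => (h t ht).differentiableAt.differentiableWithinAt, by simp, ?_⟩
    exact (hg.mul hf).congr fun t ht => (h t ht).deriv
  exact_mod_cast h1

theorem contDiffOn_of_deriv_eq_mul {K : Set ℝ} (hKo : IsOpen K) {f g : ℝ → ℝ}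
    (hg : ContDiffOn ℝ ∞ g K)
    (h : ∀ t ∈ K, HasDerivAt f (g t * f t) t) : ContDiffOn ℝ ∞ f K := by
  rw [contDiffOn_infty]
  intro n
  induction n with
  | zero =>
    exact contDiffOn_zero.2 fun t ht => (h t ht).continuousAt.continuousWithinAt
  | succ n ih =>
    exact contDiffOn_succ_of_deriv_eq_mul hKo ih (hg.of_le (by exact_mod_cast le_top)) h

/-- Read the equation as x' = (xg) x; the coefficient xg inherits the regularity of x already
reached in the induction. -/
theorem contDiffOn_of_deriv_eq_sq_mul {K : Set ℝ} (hKo : IsOpen K) {x g : ℝ → ℝ}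
    (hg : ContDiffOn ℝ ∞ g K)
    (h : ∀ t ∈ K, HasDerivAt x (x t ^ 2 * g t) t) : ContDiffOn ℝ ∞ x K := by
  rw [contDiffOn_infty]
  intro n
  induction n with
  | zero =>
    exact contDiffOn_zero.2 fun t ht => (h t ht).continuousAt.continuousWithinAt
  | succ n ih =>
    refine contDiffOn_succ_of_deriv_eq_mul hKo ih
      (ih.mul (hg.of_le (by exact_mod_cast le_top))) fun t ht => ?_
    convert h t ht using 1
    ring

/-- The autonomous system solved by `z` and `x`. -/
theorem hasDerivAt_of_vFun_equation {r k c a b : ℝ} (hr : r ≠ 0) (hc : c ≠ 0)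
    {J : Set ℝ} (hJ : ∀ s ∈ J, vDenom r k a b s ≠ 0)
    {V : ℝ → ℝ} (hV : ∀ s ∈ J, HasDerivAt V (vFun r k a b s) s)
    {K : Set ℝ} (hKo : IsOpen K) (hKc : K.OrdConnected)
    {x z : ℝ → ℝ} (hz : ContDiffOn ℝ ∞ z K) (hzJ : Set.MapsTo z K J)
    (hz_nonconst : ∃ s ∈ K, ∃ t ∈ K, z s ≠ z t)
    (hz_eq : ∀ t ∈ K, vFun r k a b (z t) * deriv z t
      - c * (a - r * z t) * Real.exp (V (z t)) = 0)
    (hx_eq : ∀ t ∈ K, x t = c * Real.exp (V (z t))) {t : ℝ} (ht : t ∈ K) :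
    HasDerivAt z (x t * vDenom r k a b (z t) / r) t ∧
      HasDerivAt x (x t ^ 2 * (a - r * z t)) t := by
  have hzc : ContinuousOn z K := hz.continuousOn
  have hVc : ContinuousOn V J := fun s hs => (hV s hs).continuousAt.continuousWithinAt
  have hg : ContinuousOn (fun t => c * Real.exp (V (z t)) * vDenom r k a b (z t) / r) K := by
    have h1 : ContinuousOn (fun t => V (z t)) K := hVc.comp hzc hzJ
    have h2 : ContinuousOn (fun t => vDenom r k a b (z t)) K := by
      unfold vDenom
      fun_prop
    fun_prop
  have hdz : deriv z t = x t * vDenom r k a b (z t) / r := by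
    rw [hx_eq t ht]
    -- The level a/r is the zero of the factor a - rz that has to be cancelled.
    refine deriv_eq_of_deriv_eq_off_level hKo hKc (hz.of_le (by norm_num)) hg ?_ hz_nonconst
      (l := a / r) ?_ ht
    · intro u hu
      have := hJ _ (hzJ hu)
      have := Real.exp_ne_zero (V (z u))
      positivity
    · intro u hu hul
      have h1 := hJ _ (hzJ hu)
      have h2 : a - r * z u ≠ 0 := by
        intro h0
        apply hul
        field_simp
        linarith
      have h3 := hz_eq u hu
      rw [vFun] at h3
      field_simp at h3 ⊢
      have h4 : (a - r * z u) * (r * deriv z u -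
          c * Real.exp (V (z u)) * vDenom r k a b (z u)) = 0 := by linear_combination h3
      linear_combination (mul_eq_zero.1 h4).resolve_left h2
  have hz' : HasDerivAt z (x t * vDenom r k a b (z t) / r) t := by
    rw [← hdz]
    exact ((hz.differentiableOn (by norm_num)).differentiableAt (hKo.mem_nhds ht)).hasDerivAt
  refine ⟨hz', ?_⟩
  -- Since V' = v, the denominator in v(z) cancels against the one in z'.
  have h1 : HasDerivAt (fun t => c * Real.exp (V (z t))) _ t :=
    (((hV _ (hzJ ht)).comp t hz').exp).const_mul c
  have h2 : x =ᶠ[𝓝 t] fun t => c * Real.exp (V (z t)) := by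
    filter_upwards [hKo.mem_nhds ht] with u hu using hx_eq u hu
  refine (h1.congr_of_eventuallyEq h2).congr_deriv ?_
  have h3 := hJ _ (hzJ ht)
  simp only [Function.comp_apply, vFun]
  rw [hx_eq t ht]
  field_simp

end ScalarEquations

/-! ### Metrics in the charts of a boundaryless manifold. -/

section Charts

variable {E : Type*} [NormedAddCommGroup E] [NormedSpace ℝ E] {M : Type*} [TopologicalSpace M]
  [ChartedSpace E M]

theorem inChart_apply {H : Type*} [TopologicalSpace H] (I : ModelWithCorners ℝ E H) {M : Type*}
    [TopologicalSpace M] [ChartedSpace H M] (g : BilinField I M) (x₀ : M) (y X Y : E) :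
    inChart I g x₀ y X Y = g ((extChartAt I x₀).symm y)
      (mfderiv 𝓘(ℝ, E) I (extChartAt I x₀).symm y X)
      (mfderiv 𝓘(ℝ, E) I (extChartAt I x₀).symm y Y) := rfl

theorem isInvertible_mfderiv_extChartAt_symm [IsManifold 𝓘(ℝ, E) ∞ M] {x₀ : M} {y : E}
    (hy : y ∈ (extChartAt 𝓘(ℝ, E) x₀).target) :
    (mfderiv 𝓘(ℝ, E) 𝓘(ℝ, E) (extChartAt 𝓘(ℝ, E) x₀).symm y).IsInvertible := by
  have : IsManifold 𝓘(ℝ, E) 1 M := .of_le (n := ∞) (by norm_num)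
  have h := isInvertible_mfderivWithin_extChartAt_symm hy
  rwa [modelWithCornersSelf_coe, Set.range_id, mfderivWithin_univ] at h

theorem mdifferentiableAt_extChartAt_symm [IsManifold 𝓘(ℝ, E) ∞ M] {x₀ : M} {y : E}
    (hy : y ∈ (extChartAt 𝓘(ℝ, E) x₀).target) :
    MDifferentiableAt 𝓘(ℝ, E) 𝓘(ℝ, E) (extChartAt 𝓘(ℝ, E) x₀).symm y := by
  have : IsManifold 𝓘(ℝ, E) 1 M := .of_le (n := ∞) (by norm_num)
  have h := mdifferentiableWithinAt_extChartAt_symm hy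
  rwa [modelWithCornersSelf_coe, Set.range_id, mdifferentiableWithinAt_univ] at h

theorem IsSemiRiemannianOn.contDiffOn_inChart {g : BilinField 𝓘(ℝ, E) M}
    (hg : IsSemiRiemannianOn 𝓘(ℝ, E) g Set.univ) (x₀ : M) :
    ContDiffOn ℝ ∞ (inChart 𝓘(ℝ, E) g x₀) (extChartAt 𝓘(ℝ, E) x₀).target := by
  simpa using hg.smooth x₀

theorem IsSemiRiemannianOn.inChart_symm {g : BilinField 𝓘(ℝ, E) M}
    (hg : IsSemiRiemannianOn 𝓘(ℝ, E) g Set.univ) (x₀ : M) (y X Y : E) :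
    inChart 𝓘(ℝ, E) g x₀ y X Y = inChart 𝓘(ℝ, E) g x₀ y Y X :=
  hg.symm _ (Set.mem_univ _) _ _

theorem IsSemiRiemannianOn.inChart_nondegenerate [IsManifold 𝓘(ℝ, E) ∞ M]
    {g : BilinField 𝓘(ℝ, E) M}
    (hg : IsSemiRiemannianOn 𝓘(ℝ, E) g Set.univ) {x₀ : M} {y : E}
    (hy : y ∈ (extChartAt 𝓘(ℝ, E) x₀).target) {X : E}
    (h : ∀ Y, inChart 𝓘(ℝ, E) g x₀ y X Y = 0) : X = 0 := by
  obtain ⟨e, he⟩ := isInvertible_mfderiv_extChartAt_symm hy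
  have h1 : e X = 0 := by
    refine hg.nondegenerate _ (Set.mem_univ _) _ fun Y => ?_
    -- Every tangent vector is the image of a coordinate vector, because the derivative of the
    -- inverse chart is an isomorphism.
    have h2 : g ((extChartAt 𝓘(ℝ, E) x₀).symm y)
      (mfderiv 𝓘(ℝ, E) 𝓘(ℝ, E) (extChartAt 𝓘(ℝ, E) x₀).symm y X)
      (mfderiv 𝓘(ℝ, E) 𝓘(ℝ, E) (extChartAt 𝓘(ℝ, E) x₀).symm y (e.symm Y)) = 0 := h (e.symm Y)
    rw [← he] at h2
    have h3 : g ((extChartAt 𝓘(ℝ, E) x₀).symm y) (e X) (e (e.symm Y)) = 0 := h2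
    rwa [e.apply_symm_apply] at h3
  exact e.injective (h1.trans (map_zero e).symm)

end Charts

/-! ### Charts of the product of a vector space and a manifold. -/

section Product

variable {E₁ E₂ : Type*} [NormedAddCommGroup E₁] [NormedSpace ℝ E₁]
    [NormedAddCommGroup E₂] [NormedSpace ℝ E₂] {F : Type*} [TopologicalSpace F]
    [ChartedSpace E₂ F]

theorem warpedMetric_apply (gB : BilinField 𝓘(ℝ, E₁) E₁) (f : E₁ → ℝ)
    (gF : BilinField 𝓘(ℝ, E₂) F) (p : E₁ × F) (X Y : E₁ × E₂) :
    warpedMetric 𝓘(ℝ, E₁) 𝓘(ℝ, E₂) gB f gF p X Y =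
      gB p.1 X.1 Y.1 + f p.1 ^ 2 * gF p.2 X.2 Y.2 := by
  have h : warpedMetric 𝓘(ℝ, E₁) 𝓘(ℝ, E₂) gB f gF p X Y =
    gB p.1 (mfderiv (𝓘(ℝ, E₁).prod 𝓘(ℝ, E₂)) 𝓘(ℝ, E₁) Prod.fst p X)
      (mfderiv (𝓘(ℝ, E₁).prod 𝓘(ℝ, E₂)) 𝓘(ℝ, E₁) Prod.fst p Y)
    + f p.1 ^ 2 * gF p.2 (mfderiv (𝓘(ℝ, E₁).prod 𝓘(ℝ, E₂)) 𝓘(ℝ, E₂) Prod.snd p X)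
      (mfderiv (𝓘(ℝ, E₁).prod 𝓘(ℝ, E₂)) 𝓘(ℝ, E₂) Prod.snd p Y) := rfl
  rw [h, mfderiv_fst, mfderiv_snd]
  rfl

theorem extChartAt_prod_symm_apply (x₀ : E₁ × F) (y : E₁ × E₂) :
    (extChartAt (𝓘(ℝ, E₁).prod 𝓘(ℝ, E₂)) x₀).symm y =
      (y.1, (extChartAt 𝓘(ℝ, E₂) x₀.2).symm y.2) := by
  rw [extChartAt_prod]
  rfl

theorem mem_extChartAt_prod_target (x₀ : E₁ × F) (y : E₁ × E₂) :
    y ∈ (extChartAt (𝓘(ℝ, E₁).prod 𝓘(ℝ, E₂)) x₀).target ↔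
      y.2 ∈ (extChartAt 𝓘(ℝ, E₂) x₀.2).target := by
  rw [extChartAt_prod, PartialEquiv.prod_target, Set.mem_prod, extChartAt_model_space_eq_id]
  simp

theorem mfderiv_extChartAt_prod_symm [IsManifold 𝓘(ℝ, E₂) ∞ F] {x₀ : E₁ × F} {y : E₁ × E₂}
    (hy : y.2 ∈ (extChartAt 𝓘(ℝ, E₂) x₀.2).target) (X : E₁ × E₂) :
    mfderiv 𝓘(ℝ, E₁ × E₂) (𝓘(ℝ, E₁).prod 𝓘(ℝ, E₂))
        (extChartAt (𝓘(ℝ, E₁).prod 𝓘(ℝ, E₂)) x₀).symm y X =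
      (X.1, mfderiv 𝓘(ℝ, E₂) 𝓘(ℝ, E₂) (extChartAt 𝓘(ℝ, E₂) x₀.2).symm y.2 X.2) := by
  have h0 : ((extChartAt (𝓘(ℝ, E₁).prod 𝓘(ℝ, E₂)) x₀).symm : E₁ × E₂ → E₁ × F) =
      fun y => (y.1, (extChartAt 𝓘(ℝ, E₂) x₀.2).symm y.2) := by
    ext1 y
    exact extChartAt_prod_symm_apply x₀ y
  have h1 : HasMFDerivAt 𝓘(ℝ, E₁ × E₂) 𝓘(ℝ, E₁) (Prod.fst : E₁ × E₂ → E₁) y (.fst ℝ E₁ E₂) :=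
    hasFDerivAt_fst.hasMFDerivAt
  have h2 : HasMFDerivAt 𝓘(ℝ, E₁ × E₂) 𝓘(ℝ, E₂) (Prod.snd : E₁ × E₂ → E₂) y (.snd ℝ E₁ E₂) :=
    hasFDerivAt_snd.hasMFDerivAt
  have h3 := h1.prodMk ((mdifferentiableAt_extChartAt_symm hy).hasMFDerivAt.comp y h2)
  rw [h0]
  exact DFunLike.congr_fun h3.mfderiv X

/-- A warped product metric in a chart of the product. -/
theorem inChart_warpedMetric [IsManifold 𝓘(ℝ, E₂) ∞ F] (gB : BilinField 𝓘(ℝ, E₁) E₁) (f : E₁ → ℝ)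
    (gF : BilinField 𝓘(ℝ, E₂) F) {x₀ : E₁ × F} {y : E₁ × E₂}
    (hy : y.2 ∈ (extChartAt 𝓘(ℝ, E₂) x₀.2).target) (X Y : E₁ × E₂) :
    inChart (𝓘(ℝ, E₁).prod 𝓘(ℝ, E₂)) (warpedMetric 𝓘(ℝ, E₁) 𝓘(ℝ, E₂) gB f gF) x₀ y X Y =
      gB y.1 X.1 Y.1 + f y.1 ^ 2 * inChart 𝓘(ℝ, E₂) gF x₀.2 y.2 X.2 Y.2 := by
  rw [inChart_apply, mfderiv_extChartAt_prod_symm hy, mfderiv_extChartAt_prod_symm hy]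
  erw [warpedMetric_apply]
  rw [extChartAt_prod_symm_apply]
  rfl

end Product

/-! ### The quasi-Einstein equation in coordinates. -/

section QuasiEinsteinCoordinates

variable {E₁ E₂ : Type*} [NormedAddCommGroup E₁] [NormedSpace ℝ E₁]
    [NormedAddCommGroup E₂] [NormedSpace ℝ E₂]
  {ξ : E₁ →L[ℝ] ℝ} {B : E₁ →L[ℝ] E₁ →L[ℝ] ℝ} {N : E₁}
  {GF : E₂ → E₂ →L[ℝ] E₂ →L[ℝ] ℝ} {A w : ℝ → ℝ}

theorem warpedCoord_nondegenerate {y : E₁ × E₂}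
    (hB : ∀ X, (∀ Y, B X Y = 0) → X = 0) (hGF : ∀ X, (∀ Y, GF y.2 X Y = 0) → X = 0)
    (hA : A (ξ y.1) ≠ 0) (hw : w (ξ y.1) ≠ 0) {X : E₁ × E₂}
    (h : ∀ Y, warpedCoord ξ B GF A w y X Y = 0) : X = 0 := by
  ext1
  · refine hB _ fun Y => ?_
    have h1 := h (Y, 0)
    simpa [hA] using h1
  · refine hGF _ fun Y => ?_
    have h1 := h (0, Y)
    simpa [hw] using h1

theorem isInvertible_warpedCoord [FiniteDimensional ℝ E₁] [FiniteDimensional ℝ E₂] {y : E₁ × E₂}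
    (hB : ∀ X, (∀ Y, B X Y = 0) → X = 0) (hGF : ∀ X, (∀ Y, GF y.2 X Y = 0) → X = 0)
    (hA : A (ξ y.1) ≠ 0) (hw : w (ξ y.1) ≠ 0) : (warpedCoord ξ B GF A w y).IsInvertible :=
  isInvertible_of_nondegenerate fun _ hX => warpedCoord_nondegenerate hB hGF hA hw hX

theorem christoffel_warpedCoord_eventuallyEq [FiniteDimensional ℝ E₁] [FiniteDimensional ℝ E₂]
    {k : ℝ} {K : Set ℝ} (hKo : IsOpen K) {x f φ : ℝ → ℝ}
    (hf : ∀ t ∈ K, HasDerivAt f (x t * f t) t) (hf0 : ∀ t ∈ K, f t ≠ 0)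
    (hφ : ∀ t ∈ K, HasDerivAt φ (k * x t * φ t) t) (hφ0 : ∀ t ∈ K, φ t ≠ 0)
    (hB : ∀ X, (∀ Y, B X Y = 0) → X = 0) (hN : ∀ X, B N X = ξ X)
    {y : E₁ × E₂} (hy : ξ y.1 ∈ K) (hGF : ContDiffAt ℝ 2 GF y.2)
    (hGFn : ∀ᶠ v in 𝓝 y.2, ∀ X, (∀ Y, GF v X Y = 0) → X = 0) :
    christoffel (warpedCoord ξ B GF (fun t => 1 / φ t ^ 2) (fun t => f t ^ 2)) =ᶠ[𝓝 y]
      warpedChristoffel ξ B N GF (fun t => k * x t) x (fun t => φ t ^ 2 * (x t * f t ^ 2)) := by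
  have hK : ∀ᶠ y' in 𝓝 y, ξ y'.1 ∈ K :=
    (ξ.comp (.fst ℝ E₁ E₂)).continuous.continuousAt.eventually_mem (hKo.mem_nhds hy)
  have hsnd : Filter.Tendsto (Prod.snd : E₁ × E₂ → E₂) (𝓝 y) (𝓝 y.2) :=
    continuous_snd.continuousAt
  have hA : ∀ t ∈ K, HasDerivAt (fun t => 1 / φ t ^ 2) (-2 * (k * x t) * (1 / φ t ^ 2)) t := by
    intro t ht
    have h1 := hφ0 t ht
    have h2 : HasDerivAt (fun t => φ t ^ 2) (2 * φ t * (k * x t * φ t)) t :=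
      ((hφ t ht).pow 2).congr_deriv (by ring)
    simp only [one_div]
    refine (h2.fun_inv (pow_ne_zero 2 h1)).congr_deriv ?_
    field_simp
  have hw : ∀ t ∈ K, HasDerivAt (fun t => f t ^ 2) (2 * x t * f t ^ 2) t := fun t ht =>
    ((hf t ht).pow 2).congr_deriv (by ring)
  filter_upwards [hK, hsnd.eventually hGFn, hsnd.eventually (hGF.eventually (by norm_num))]
    with y' h1 h2 h3
  have hφ1 := hφ0 (ξ y'.1) h1
  -- With A = φ⁻² and w = f², the condition sA = qw forces s = φ² x f².
  have hs : φ (ξ y'.1) ^ 2 * (x (ξ y'.1) * f (ξ y'.1) ^ 2) * (1 / φ (ξ y'.1) ^ 2) =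
      x (ξ y'.1) * f (ξ y'.1) ^ 2 := by field_simp
  exact christoffel_warpedCoord (A := fun t => 1 / φ t ^ 2) (w := fun t => f t ^ 2)
    (p := fun t => k * x t) (s := fun t => φ t ^ 2 * (x t * f t ^ 2)) hN
    (hA (ξ y'.1) h1) (hw (ξ y'.1) h1) hs (h3.differentiableAt two_ne_zero)
    (isInvertible_of_nondegenerate h2) (isInvertible_warpedCoord hB h2
      (one_div_ne_zero (pow_ne_zero 2 hφ1)) (pow_ne_zero 2 (hf0 (ξ y'.1) h1)))

/-- The quasi-Einstein equation for the warped product in coordinates. -/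
theorem ricciCoord_sub_hessCoord_warpedCoord [FiniteDimensional ℝ E₁] [FiniteDimensional ℝ E₂]
    {r k a b : ℝ} (hr : r ≠ 0)
    (ha : a = ((Module.finrank ℝ E₁ : ℝ) - 2) * k - Module.finrank ℝ E₂)
    (hb : b = Module.finrank ℝ E₂ * (2 * k + 1) - ((Module.finrank ℝ E₁ : ℝ) - 2) * k ^ 2)
    {K : Set ℝ} (hKo : IsOpen K) {x z f φ h : ℝ → ℝ}
    (hz : ∀ t ∈ K, HasDerivAt z (x t * vDenom r k a b (z t) / r) t)
    (hx : ∀ t ∈ K, HasDerivAt x (x t ^ 2 * (a - r * z t)) t)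
    (hf : ∀ t ∈ K, HasDerivAt f (x t * f t) t) (hf0 : ∀ t ∈ K, f t ≠ 0)
    (hφ : ∀ t ∈ K, HasDerivAt φ (k * x t * φ t) t) (hφ0 : ∀ t ∈ K, φ t ≠ 0)
    (hh : ∀ t ∈ K, HasDerivAt h (x t * z t * h t) t) (hh0 : ∀ t ∈ K, h t ≠ 0)
    (hBs : ∀ X Y, B X Y = B Y X) (hB : ∀ X, (∀ Y, B X Y = 0) → X = 0) (hN : ∀ X, B N X = ξ X)
    {y : E₁ × E₂} (hy : ξ y.1 ∈ K) (hGF : ContDiffAt ℝ 2 GF y.2)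
    (hGFs : ∀ᶠ v in 𝓝 y.2, ∀ X Y, GF v X Y = GF v Y X)
    (hGFn : ∀ᶠ v in 𝓝 y.2, ∀ X, (∀ Y, GF v X Y = 0) → X = 0) (V W : E₁ × E₂)
    (hRic : ricciCoord GF y.2 V.2 W.2 = 0) :
    ricciCoord (warpedCoord ξ B GF (fun t => 1 / φ t ^ 2) (fun t => f t ^ 2)) y V W
      - r / h (ξ y.1) * hessCoord (warpedCoord ξ B GF (fun t => 1 / φ t ^ 2) (fun t => f t ^ 2))
        (fun y => h (ξ y.1)) y V W = 0 := by
  have hG := christoffel_warpedCoord_eventuallyEq hKo hf hf0 hφ hφ0 hB hN hy hGF hGFn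
  have hΓ := differentiableAt_christoffel hGF (isInvertible_of_nondegenerate hGFn.self_of_nhds)
  set t := ξ y.1 with ht
  have hx' := hx t hy
  have hp : HasDerivAt (fun t => k * x t) (k * (x t ^ 2 * (a - r * z t))) t := hx'.const_mul k
  have hs : HasDerivAt (fun t => φ t ^ 2 * (x t * f t ^ 2))
      (φ t ^ 2 * (x t * f t ^ 2) * (2 * k * x t + 2 * x t + x t * (a - r * z t))) t :=
    (((hφ t hy).pow 2).mul (hx'.mul ((hf t hy).pow 2))).congr_deriv (by
      simp only [Pi.mul_apply, Pi.pow_apply]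
      push_cast
      ring)
  have hh' : HasDerivAt (fun t => x t * z t * h t)
      (h t * x t ^ 2 * ((a - r * z t) * z t + vDenom r k a b (z t) / r + z t ^ 2)) t :=
    ((hx'.mul (hz t hy)).mul (hh t hy)).congr_deriv (by
      simp only [Pi.mul_apply]
      ring)
  rw [ricciCoord_of_christoffel_eq hG hBs hN hGFs hp hx' hs
      (hGF.differentiableAt (by norm_num)) hΓ, hRic,
    hessCoord_of_christoffel_eq hG.eq_of_nhds (Filter.mem_of_superset (hKo.mem_nhds hy) hh) hh']
  have h0 := hh0 t hy
  simp only [← ht]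
  generalize (Module.finrank ℝ E₁ : ℝ) = n at *
  generalize (Module.finrank ℝ E₂ : ℝ) = m at *
  -- Coefficient of ξ⊗ξ. It contains h'' and hence z'; using `ha` and `hb`, the quadratic `vDenom`
  -- is what makes it vanish.
  have c1 : (n - 2) * (k * (x t ^ 2 * (a - r * z t)) + (k * x t) ^ 2)
      - m * (x t ^ 2 * (a - r * z t) + x t ^ 2 + 2 * (k * x t) * x t)
      - r / h t * (h t * x t ^ 2 * ((a - r * z t) * z t + vDenom r k a b (z t) / r + z t ^ 2)
        + 2 * (k * x t) * (x t * z t * h t)) = 0 := by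
    field_simp
    rw [vDenom, hb, ha]
    ring
  -- Coefficient of ξ(N) B: the terms in z cancel, leaving k x² (a - (n-2)k + m).
  have c2 : k * (x t ^ 2 * (a - r * z t)) - (n - 2) * (k * x t) ^ 2 + m * (k * x t) * x t
      + r / h t * (x t * z t * h t * (k * x t)) = 0 := by
    field_simp
    rw [ha]
    ring
  -- Coefficient of ξ(N) g_F, with the common factor s removed; it is x (a - (n-2)k + m).
  have c3 : 2 * k * x t + 2 * x t + x t * (a - r * z t) - n * (k * x t) + (m - 2) * x t
      + r / h t * (x t * z t * h t) = 0 := by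
    field_simp
    rw [ha]
    ring
  linear_combination (ξ V.1 * ξ W.1) * c1 + (ξ N * B V.1 W.1) * c2
    - (φ t ^ 2 * (x t * f t ^ 2) * ξ N * GF y.2 V.2 W.2) * c3

end QuasiEinsteinCoordinates

/-! ### The pseudo-Euclidean base and the signature of the warped product. -/

section PseudoEuclidean

/-- Ricci-flatness speaks only of images of tangent vectors under the derivative of the chart; that
derivative is an isomorphism, so every pair of coordinate vectors is reached. -/
theorem IsRicciFlat.ricciCoord_eq_zero {E : Type*} [NormedAddCommGroup E] [NormedSpace ℝ E]
    {M : Type*} [TopologicalSpace M] [ChartedSpace E M] [IsManifold 𝓘(ℝ, E) ∞ M]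
    {g : BilinField 𝓘(ℝ, E) M} (hg : IsRicciFlat 𝓘(ℝ, E) g) (x : M) (v w : E) :
    ricciCoord (inChart 𝓘(ℝ, E) g x) (extChartAt 𝓘(ℝ, E) x x) v w = 0 := by
  have : IsManifold 𝓘(ℝ, E) 1 M := .of_le (n := ∞) (by norm_num)
  obtain ⟨e, he⟩ := isInvertible_mfderiv_extChartAt (I := 𝓘(ℝ, E)) (mem_extChartAt_source x)
  have h := hg x (e.symm v) (e.symm w)
  rw [ricci, ← he] at h
  have hv : e (e.symm v) = v := e.apply_symm_apply v
  have hw : e (e.symm w) = w := e.apply_symm_apply w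
  exact (congrArg₂ (ricciCoord (inChart 𝓘(ℝ, E) g x) (extChartAt 𝓘(ℝ, E) x x)) hv hw).symm.trans h

variable {n : ℕ} {ε : Fin n → ℝ}

/-- The pseudo-Euclidean scalar product as a bilinear form. -/
def pseudoEuclideanForm (ε : Fin n → ℝ) : EuclideanSpace ℝ (Fin n) →L[ℝ] EuclideanSpace ℝ (Fin n) →L[ℝ] ℝ :=
  ∑ i, ε i • ContinuousLinearMap.smulRight
    (EuclideanSpace.proj i : EuclideanSpace ℝ (Fin n) →L[ℝ] ℝ)
    (EuclideanSpace.proj i : EuclideanSpace ℝ (Fin n) →L[ℝ] ℝ)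

/-- The linear form `p ↦ ∑ α_i p_i`. -/
def coordForm (α : Fin n → ℝ) : EuclideanSpace ℝ (Fin n) →L[ℝ] ℝ := ∑ i, α i • EuclideanSpace.proj i

theorem coordForm_apply (α : Fin n → ℝ) (p : EuclideanSpace ℝ (Fin n)) : coordForm α p = ∑ i, α i * p i := by
  simp [coordForm]

theorem pseudoEuclideanForm_apply (X Y : EuclideanSpace ℝ (Fin n)) :
    pseudoEuclideanForm ε X Y = ∑ i, ε i * (X i * Y i) := by
  simp [pseudoEuclideanForm, sum_apply]

theorem pseudoEuclideanForm_symm (X Y : EuclideanSpace ℝ (Fin n)) :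
    pseudoEuclideanForm ε X Y = pseudoEuclideanForm ε Y X := by
  simp only [pseudoEuclideanForm_apply, mul_comm]

theorem pseudoEuclideanForm_basisFun (X : EuclideanSpace ℝ (Fin n)) (i : Fin n) :
    pseudoEuclideanForm ε X (EuclideanSpace.basisFun (Fin n) ℝ i) = ε i * X i := by
  rw [pseudoEuclideanForm_apply, Finset.sum_eq_single i] <;> simp +contextual

theorem pseudoEuclideanForm_nondegenerate (hε : ∀ i, ε i = 1 ∨ ε i = -1) (X : EuclideanSpace ℝ (Fin n))
    (h : ∀ Y, pseudoEuclideanForm ε X Y = 0) : X = 0 := by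
  ext i
  have h1 := h (EuclideanSpace.basisFun (Fin n) ℝ i)
  rw [pseudoEuclideanForm_basisFun] at h1
  rcases hε i with h2 | h2 <;> simpa [h2] using h1

/-- Raising the index multiplies by the sign, and ε_i² = 1. This provides the vector N. -/
theorem pseudoEuclideanForm_gradient (hε : ∀ i, ε i = 1 ∨ ε i = -1) (α : Fin n → ℝ) (X : EuclideanSpace ℝ (Fin n)) :
    pseudoEuclideanForm ε (WithLp.toLp 2 fun i => ε i * α i) X = coordForm α X := by
  rw [pseudoEuclideanForm_apply, coordForm_apply]
  refine Finset.sum_congr rfl fun i _ => ?_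
  rcases hε i with h | h <;> simp [h]

variable {E₂ : Type*} [NormedAddCommGroup E₂] [NormedSpace ℝ E₂] {F : Type*} [TopologicalSpace F]
    [ChartedSpace E₂ F] {gF : BilinField 𝓘(ℝ, E₂) F} {ξ : EuclideanSpace ℝ (Fin n) →L[ℝ] ℝ} {K : Set ℝ} {f φ h : ℝ → ℝ}

theorem warpedMetric_conformalMetric_apply (p : EuclideanSpace ℝ (Fin n) × F) (X Y : EuclideanSpace ℝ (Fin n) × E₂) :
    warpedMetric 𝓘(ℝ, EuclideanSpace ℝ (Fin n)) 𝓘(ℝ, E₂) (conformalMetric ε (fun p => φ (ξ p))) (fun p => f (ξ p)) gF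
        p X Y =
      1 / φ (ξ p.1) ^ 2 * pseudoEuclideanForm ε X.1 Y.1 + f (ξ p.1) ^ 2 * gF p.2 X.2 Y.2 :=
  warpedMetric_apply _ _ _ p X Y

theorem inChart_warpedMetric_conformalMetric [IsManifold 𝓘(ℝ, E₂) ∞ F] {x₀ : EuclideanSpace ℝ (Fin n) × F} {y : EuclideanSpace ℝ (Fin n) × E₂}
    (hy : y.2 ∈ (extChartAt 𝓘(ℝ, E₂) x₀.2).target) :
    inChart (𝓘(ℝ, EuclideanSpace ℝ (Fin n)).prod 𝓘(ℝ, E₂)) (warpedMetric 𝓘(ℝ, EuclideanSpace ℝ (Fin n)) 𝓘(ℝ, E₂)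
        (conformalMetric ε (fun p => φ (ξ p))) (fun p => f (ξ p)) gF) x₀ y =
      warpedCoord ξ (pseudoEuclideanForm ε) (inChart 𝓘(ℝ, E₂) gF x₀.2) (fun t => 1 / φ t ^ 2)
        (fun t => f t ^ 2) y := by
  refine ContinuousLinearMap.ext fun X => ContinuousLinearMap.ext fun Y => ?_
  exact inChart_warpedMetric _ _ _ hy X Y

theorem contDiffOn_warpedCoord {GF : E₂ → E₂ →L[ℝ] E₂ →L[ℝ] ℝ} {T : Set E₂}
    (hGF : ContDiffOn ℝ ∞ GF T) {A w : ℝ → ℝ} (hA : ContDiffOn ℝ ∞ A K) (hw : ContDiffOn ℝ ∞ w K) :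
    ContDiffOn ℝ ∞ (warpedCoord ξ (pseudoEuclideanForm ε) GF A w) {y | ξ y.1 ∈ K ∧ y.2 ∈ T} := by
  have hξ : ContDiffOn ℝ ∞ (fun y : EuclideanSpace ℝ (Fin n) × E₂ => ξ y.1) {y | ξ y.1 ∈ K ∧ y.2 ∈ T} :=
    (ξ.comp (.fst ℝ (EuclideanSpace ℝ (Fin n)) E₂)).contDiff.contDiffOn
  have h1 : ContDiffOn ℝ ∞ (fun y : EuclideanSpace ℝ (Fin n) × E₂ => A (ξ y.1)) {y | ξ y.1 ∈ K ∧ y.2 ∈ T} :=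
    hA.comp hξ fun y hy => hy.1
  have h2 : ContDiffOn ℝ ∞ (fun y : EuclideanSpace ℝ (Fin n) × E₂ => w (ξ y.1)) {y | ξ y.1 ∈ K ∧ y.2 ∈ T} :=
    hw.comp hξ fun y hy => hy.1
  have h3 : ContDiffOn ℝ ∞ (fun y : EuclideanSpace ℝ (Fin n) × E₂ => GF y.2) {y | ξ y.1 ∈ K ∧ y.2 ∈ T} :=
    hGF.comp contDiff_snd.contDiffOn fun y hy => hy.2
  exact (h1.smul contDiffOn_const).add
    (h2.smul ((fiberForm (EuclideanSpace ℝ (Fin n)) E₂ (.id ℝ ℝ)).contDiff.comp_contDiffOn h3))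

/-- Scaling the standard basis by φ and an orthonormal basis of the fibre by 1/f undoes the two
factors of the metric, so the signs are those of ε and of g_F at every point. -/
theorem exists_signature_warpedMetric (hε : ∀ i, ε i = 1 ∨ ε i = -1)
    (hgF : IsSemiRiemannianOn 𝓘(ℝ, E₂) gF Set.univ)
    (hφ0 : ∀ t ∈ K, φ t ≠ 0) (hf0 : ∀ t ∈ K, f t ≠ 0) :
    ∃ (ι : Type) (s : ι → ℝ), (∀ i, s i = 1 ∨ s i = -1) ∧
      ∀ p ∈ {p : EuclideanSpace ℝ (Fin n) × F | ξ p.1 ∈ K},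
        ∃ e : Module.Basis ι ℝ (TangentSpace (𝓘(ℝ, EuclideanSpace ℝ (Fin n)).prod 𝓘(ℝ, E₂)) p),
          (∀ i, warpedMetric 𝓘(ℝ, EuclideanSpace ℝ (Fin n)) 𝓘(ℝ, E₂) (conformalMetric ε (fun p => φ (ξ p)))
            (fun p => f (ξ p)) gF p (e i) (e i) = s i) ∧
          ∀ i j, i ≠ j → warpedMetric 𝓘(ℝ, EuclideanSpace ℝ (Fin n)) 𝓘(ℝ, E₂) (conformalMetric ε (fun p => φ (ξ p)))
            (fun p => f (ξ p)) gF p (e i) (e j) = 0 := by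
  obtain ⟨ι, s, hs, hb⟩ := hgF.signature
  refine ⟨Fin n ⊕ ι, Sum.elim ε s, by rintro (i | i); exacts [hε i, hs i], fun p hp => ?_⟩
  classical
  let g : E₂ →L[ℝ] E₂ →L[ℝ] ℝ := gF p.2
  obtain ⟨e, he1, he2⟩ : ∃ e : Module.Basis ι ℝ E₂, (∀ i, g (e i) (e i) = s i) ∧
    ∀ i j, i ≠ j → g (e i) (e j) = 0 := hb p.2 (Set.mem_univ _)
  have hφ := hφ0 _ hp
  have hf := hf0 _ hp
  let e₁ : Module.Basis (Fin n) ℝ (EuclideanSpace ℝ (Fin n)) :=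
    (EuclideanSpace.basisFun (Fin n) ℝ).toBasis.unitsSMul fun _ => Units.mk0 _ hφ
  let e₂ : Module.Basis ι ℝ E₂ := Module.Basis.unitsSMul e fun _ => (Units.mk0 _ hf)⁻¹
  have h1 : ∀ i, e₁ i = φ (ξ p.1) • EuclideanSpace.basisFun (Fin n) ℝ i := fun i => by
    simp [e₁, Module.Basis.unitsSMul_apply, Units.smul_def]
  have h2 : ∀ i, e₂ i = (f (ξ p.1))⁻¹ • e i := fun i =>
    Module.Basis.unitsSMul_apply (v := e) i
  have g1 : ∀ i j, pseudoEuclideanForm ε (e₁ i) (e₁ j) =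
      if i = j then φ (ξ p.1) ^ 2 * ε j else 0 := fun i j => by
    rw [h1, h1, map_smul, map_smul, smul_apply, pseudoEuclideanForm_basisFun]
    rcases eq_or_ne i j with rfl | hij
    · simp
      ring
    · simp [hij, hij.symm]
  have g2 : ∀ i j, g (e₂ i) (e₂ j) = (f (ξ p.1) ^ 2)⁻¹ * g (e i) (e j) := fun i j => by
    rw [h2, h2, map_smul, map_smul, smul_apply, smul_eq_mul, smul_eq_mul, ← mul_assoc, ← mul_inv,
      ← sq]
  let e' : Module.Basis (Fin n ⊕ ι) ℝ (EuclideanSpace ℝ (Fin n) × E₂) := e₁.prod e₂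
  have key : ∀ i j, 1 / φ (ξ p.1) ^ 2 * pseudoEuclideanForm ε (e' i).1 (e' j).1
      + f (ξ p.1) ^ 2 * g (e' i).2 (e' j).2 = if i = j then Sum.elim ε s i else 0 := by
    rintro (i | i) (j | j)
    · rcases eq_or_ne i j with rfl | hij
      · simp [e', g1, hφ]
      · simp [e', g1, hij]
    · simp [e']
    · simp [e']
    · rcases eq_or_ne i j with rfl | hij
      · simp [e', g2, he1, hf]
      · simp [e', g2, he2 i j hij, hij]
  exact ⟨e', fun i => (warpedMetric_conformalMetric_apply p (e' i) (e' i)).trans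
      ((key i i).trans (if_pos rfl)),
    fun i j hij => (warpedMetric_conformalMetric_apply p (e' i) (e' j)).trans
      ((key i j).trans (if_neg hij))⟩

end PseudoEuclidean

/-! ### From coordinates back to the manifold. -/

section QuasiEinstein

variable {n : ℕ} {ε : Fin n → ℝ}
  {E₂ : Type*} [NormedAddCommGroup E₂] [NormedSpace ℝ E₂] {F : Type*} [TopologicalSpace F]
  [ChartedSpace E₂ F] [IsManifold 𝓘(ℝ, E₂) ∞ F] {gF : BilinField 𝓘(ℝ, E₂) F}
  {ξ : EuclideanSpace ℝ (Fin n) →L[ℝ] ℝ} {K : Set ℝ} {f φ h : ℝ → ℝ}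

/-- A warped product over a conformally pseudo-Euclidean base is semi-Riemannian. -/
theorem isSemiRiemannianOn_warpedMetric_conformalMetric (hε : ∀ i, ε i = 1 ∨ ε i = -1)
    (hgF : IsSemiRiemannianOn 𝓘(ℝ, E₂) gF Set.univ) (hKo : IsOpen K)
    (hφ : ContDiffOn ℝ ∞ φ K) (hφ0 : ∀ t ∈ K, φ t ≠ 0)
    (hf : ContDiffOn ℝ ∞ f K) (hf0 : ∀ t ∈ K, f t ≠ 0) :
    IsSemiRiemannianOn (𝓘(ℝ, EuclideanSpace ℝ (Fin n)).prod 𝓘(ℝ, E₂))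
      (warpedMetric 𝓘(ℝ, EuclideanSpace ℝ (Fin n)) 𝓘(ℝ, E₂)
        (conformalMetric ε (fun p => φ (ξ p))) (fun p => f (ξ p)) gF)
      {p : EuclideanSpace ℝ (Fin n) × F | ξ p.1 ∈ K} where
  isOpen := hKo.preimage (ξ.continuous.comp continuous_fst)
  smooth x₀ := by
    have hA : ContDiffOn ℝ ∞ (fun t => 1 / φ t ^ 2) K :=
      contDiffOn_const.div (hφ.pow 2) fun t ht => pow_ne_zero 2 (hφ0 t ht)
    refine ((contDiffOn_warpedCoord (ξ := ξ) (ε := ε) (hgF.contDiffOn_inChart x₀.2) hA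
      (hf.pow 2)).mono ?_).congr fun y hy => ?_
    · rintro y ⟨hy, hyK⟩
      rw [Set.mem_preimage, extChartAt_prod_symm_apply] at hyK
      exact ⟨hyK, (mem_extChartAt_prod_target x₀ y).1 hy⟩
    · exact inChart_warpedMetric_conformalMetric ((mem_extChartAt_prod_target x₀ y).1 hy.1)
  symm p _ X Y := (warpedMetric_conformalMetric_apply p X Y).trans <|
    (congrArg₂ (fun u v => 1 / φ (ξ p.1) ^ 2 * u + f (ξ p.1) ^ 2 * v)
      (pseudoEuclideanForm_symm X.1 Y.1) (hgF.symm p.2 (Set.mem_univ _) X.2 Y.2)).trans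
    (warpedMetric_conformalMetric_apply p Y X).symm
  nondegenerate p hp X hX := by
    have hφ := hφ0 _ hp
    have hf := hf0 _ hp
    let g : E₂ →L[ℝ] E₂ →L[ℝ] ℝ := gF p.2
    have h : ∀ Y : EuclideanSpace ℝ (Fin n) × E₂, 1 / φ (ξ p.1) ^ 2 *
        pseudoEuclideanForm ε X.1 Y.1 + f (ξ p.1) ^ 2 * g X.2 Y.2 = 0 := fun Y =>
      (warpedMetric_conformalMetric_apply p X Y).symm.trans (hX Y)
    refine Prod.ext (pseudoEuclideanForm_nondegenerate hε _ fun Y => ?_)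
      (hgF.nondegenerate p.2 (Set.mem_univ _) _ fun Y => ?_)
    · simpa [hφ] using h (Y, 0)
    · have h1 : g X.2 Y = 0 := by simpa [hf] using h (0, Y)
      exact h1
  signature := exists_signature_warpedMetric hε hgF hφ0 hf0

/-- The quasi-Einstein equation follows from the system of ordinary differential equations
for `z`, `x`, `f`, `φ` and `h`. -/
theorem isQuasiEinsteinOn_warpedMetric_conformalMetric [FiniteDimensional ℝ E₂]
    (hε : ∀ i, ε i = 1 ∨ ε i = -1)
    (hgF : IsSemiRiemannianOn 𝓘(ℝ, E₂) gF Set.univ) (hRic : IsRicciFlat 𝓘(ℝ, E₂) gF)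
    {N : EuclideanSpace ℝ (Fin n)} (hN : ∀ X, pseudoEuclideanForm ε N X = ξ X)
    {r k a b : ℝ} (hr : r ≠ 0) (ha : a = ((n : ℝ) - 2) * k - Module.finrank ℝ E₂)
    (hb : b = Module.finrank ℝ E₂ * (2 * k + 1) - ((n : ℝ) - 2) * k ^ 2)
    (hKo : IsOpen K) {x z : ℝ → ℝ} (hzK : ContDiffOn ℝ ∞ z K)
    (hz : ∀ t ∈ K, HasDerivAt z (x t * vDenom r k a b (z t) / r) t)
    (hx : ∀ t ∈ K, HasDerivAt x (x t ^ 2 * (a - r * z t)) t)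
    (hf : ∀ t ∈ K, HasDerivAt f (x t * f t) t) (hf0 : ∀ t ∈ K, f t ≠ 0)
    (hφ : ∀ t ∈ K, HasDerivAt φ (k * x t * φ t) t) (hφ0 : ∀ t ∈ K, φ t ≠ 0)
    (hh : ∀ t ∈ K, HasDerivAt h (x t * z t * h t) t) (hh0 : ∀ t ∈ K, h t ≠ 0) :
    IsQuasiEinsteinOn (𝓘(ℝ, EuclideanSpace ℝ (Fin n)).prod 𝓘(ℝ, E₂))
      (warpedMetric 𝓘(ℝ, EuclideanSpace ℝ (Fin n)) 𝓘(ℝ, E₂)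
        (conformalMetric ε (fun p => φ (ξ p))) (fun p => f (ξ p)) gF)
      (fun p : EuclideanSpace ℝ (Fin n) × F => h (ξ p.1)) r 0
      {p : EuclideanSpace ℝ (Fin n) × F | ξ p.1 ∈ K} := by
  -- Smoothness of x comes first: it is the coefficient in the linear equations of φ, f and h.
  have hxK : ContDiffOn ℝ ∞ x K :=
    contDiffOn_of_deriv_eq_sq_mul hKo (contDiffOn_const.sub (contDiffOn_const.mul hzK)) hx
  have hφK : ContDiffOn ℝ ∞ φ K := contDiffOn_of_deriv_eq_mul hKo (contDiffOn_const.mul hxK) hφ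
  have hfK : ContDiffOn ℝ ∞ f K := contDiffOn_of_deriv_eq_mul hKo hxK hf
  have hhK : ContDiffOn ℝ ∞ h K := contDiffOn_of_deriv_eq_mul hKo (hxK.mul hzK) hh
  refine ⟨isSemiRiemannianOn_warpedMetric_conformalMetric hε hgF hKo hφK hφ0 hfK hf0, ?_,
    fun p hp => hh0 _ hp, fun p hp X Y => ?_⟩
  · have h1 : ContMDiff (𝓘(ℝ, EuclideanSpace ℝ (Fin n)).prod 𝓘(ℝ, E₂)) 𝓘(ℝ) ∞
        (fun p : EuclideanSpace ℝ (Fin n) × F => ξ p.1) :=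
      ξ.contMDiff.comp contMDiff_fst
    exact hhK.contMDiffOn.comp h1.contMDiffOn fun p hp => hp
  · rw [zero_mul]
    set y := extChartAt (𝓘(ℝ, EuclideanSpace ℝ (Fin n)).prod 𝓘(ℝ, E₂)) p p with hy
    have hy1 : y.1 = p.1 := by rw [hy, extChartAt_prod]; rfl
    have hy2 : y.2 = extChartAt 𝓘(ℝ, E₂) p.2 p.2 := by rw [hy, extChartAt_prod]; rfl
    -- The coordinate formula must hold on a neighbourhood, since Ricci tensor and Hessian involve
    -- derivatives of the metric.
    have hT : (extChartAt 𝓘(ℝ, E₂) p.2).target ∈ 𝓝 y.2 := hy2 ▸ extChartAt_target_mem_nhds p.2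
    have hG : inChart (𝓘(ℝ, EuclideanSpace ℝ (Fin n)).prod 𝓘(ℝ, E₂))
        (warpedMetric 𝓘(ℝ, EuclideanSpace ℝ (Fin n)) 𝓘(ℝ, E₂)
          (conformalMetric ε (fun p => φ (ξ p))) (fun p => f (ξ p)) gF) p =ᶠ[𝓝 y]
        warpedCoord ξ (pseudoEuclideanForm ε) (inChart 𝓘(ℝ, E₂) gF p.2) (fun t => 1 / φ t ^ 2)
          (fun t => f t ^ 2) := by
      filter_upwards [continuous_snd.continuousAt.preimage_mem_nhds hT] with y' hy'
        using inChart_warpedMetric_conformalMetric hy'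
    have hH : (fun p : EuclideanSpace ℝ (Fin n) × F => h (ξ p.1)) ∘
        (extChartAt (𝓘(ℝ, EuclideanSpace ℝ (Fin n)).prod 𝓘(ℝ, E₂)) p).symm =
        fun y => h (ξ y.1) := by
      ext y'
      rw [Function.comp_apply, extChartAt_prod_symm_apply]
    have key := fun V W => ricciCoord_sub_hessCoord_warpedCoord (E₁ := EuclideanSpace ℝ (Fin n))
      (E₂ := E₂) (ξ := ξ) (B := pseudoEuclideanForm ε) (N := N) (y := y)
      (GF := inChart 𝓘(ℝ, E₂) gF p.2) hr (by rwa [finrank_euclideanSpace_fin])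
      (by rwa [finrank_euclideanSpace_fin]) hKo hz hx hf hf0 hφ hφ0 hh hh0 pseudoEuclideanForm_symm
      (pseudoEuclideanForm_nondegenerate hε) hN (hy1 ▸ hp)
      (contDiffAt_infty.1 ((hgF.contDiffOn_inChart p.2).contDiffAt hT) 2)
      (.of_forall (hgF.inChart_symm p.2))
      (Filter.mem_of_superset hT fun v hv X => hgF.inChart_nondegenerate hv) V W
      (hy2 ▸ hRic.ricciCoord_eq_zero p.2 V.2 W.2)
    have key' : ∀ V W, ricciCoord (inChart (𝓘(ℝ, EuclideanSpace ℝ (Fin n)).prod 𝓘(ℝ, E₂))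
        (warpedMetric 𝓘(ℝ, EuclideanSpace ℝ (Fin n)) 𝓘(ℝ, E₂)
          (conformalMetric ε (fun p => φ (ξ p))) (fun p => f (ξ p)) gF) p) y V W
        - r / h (ξ p.1) * hessCoord (inChart (𝓘(ℝ, EuclideanSpace ℝ (Fin n)).prod 𝓘(ℝ, E₂))
          (warpedMetric 𝓘(ℝ, EuclideanSpace ℝ (Fin n)) 𝓘(ℝ, E₂)
            (conformalMetric ε (fun p => φ (ξ p))) (fun p => f (ξ p)) gF) p)
          ((fun p : EuclideanSpace ℝ (Fin n) × F => h (ξ p.1)) ∘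
            (extChartAt (𝓘(ℝ, EuclideanSpace ℝ (Fin n)).prod 𝓘(ℝ, E₂)) p).symm) y V W = 0 := by
      intro V W
      rw [hH, ricciCoord_congr hG, hessCoord_congr hG (.refl _ _), ← hy1]
      exact key V W
    exact key' _ _

end QuasiEinstein

end SemiRiemannian
end

/-! ### The main theorem. -/

theorem mainTheorem8 (n m r : ℕ) (hn : 3 ≤ n) (hm : 1 ≤ m) (hr : 1 ≤ r)
    -- the Ricci-flat semi-Riemannian fibre
    {F : Type*} [TopologicalSpace F] [ChartedSpace (EuclideanSpace ℝ (Fin m)) F]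
    [IsManifold 𝓘(ℝ, EuclideanSpace ℝ (Fin m)) ∞ F]
    (gF : SemiRiemannian.BilinField 𝓘(ℝ, EuclideanSpace ℝ (Fin m)) F)
    (hgF : SemiRiemannian.IsSemiRiemannianOn 𝓘(ℝ, EuclideanSpace ℝ (Fin m)) gF Set.univ)
    (hRic : SemiRiemannian.IsRicciFlat 𝓘(ℝ, EuclideanSpace ℝ (Fin m)) gF)
    -- the pseudo-Euclidean signs and the non-null direction
    (ε : Fin n → ℝ) (hε : ∀ i, ε i = 1 ∨ ε i = -1)
    (α : Fin n → ℝ) (i₀ : Fin n) (hα : ∑ i, ε i * α i ^ 2 = ε i₀)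
    (k c a b : ℝ) (hk : 0 < k) (hc : 0 < c)
    (ha : a = ((n : ℝ) - 2) * k - m) (hb : b = m * (2 * k + 1) - ((n : ℝ) - 2) * k ^ 2)
    -- `V` is an antiderivative of `v` on the open interval `J`
    (J : Set ℝ) (hJo : IsOpen J) (hJc : J.OrdConnected)
    (hJ : ∀ s ∈ J, SemiRiemannian.vDenom r k a b s ≠ 0)
    (V : ℝ → ℝ) (hV : ∀ s ∈ J, HasDerivAt V (SemiRiemannian.vFun r k a b s) s)
    -- `z` and `x` on the open interval `K`
    (K : Set ℝ) (hKo : IsOpen K) (hKc : K.OrdConnected)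
    (x z : ℝ → ℝ) (hz : ContDiffOn ℝ ∞ z K) (hzJ : Set.MapsTo z K J)
    (hz_nonconst : ∃ s ∈ K, ∃ t ∈ K, z s ≠ z t)
    (hz_eq : ∀ t ∈ K, SemiRiemannian.vFun r k a b (z t) * deriv z t
      - c * (a - r * z t) * Real.exp (V (z t)) = 0)
    (hx_eq : ∀ t ∈ K, x t = c * Real.exp (V (z t)))
    -- `f`, `φ` and `h` are obtained by integration
    (f φ h : ℝ → ℝ)
    (hf : DifferentiableOn ℝ f K) (hφ : DifferentiableOn ℝ φ K) (hh : DifferentiableOn ℝ h K)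
    (hf_pos : ∀ t ∈ K, 0 < f t) (hφ_ne : ∀ t ∈ K, φ t ≠ 0) (hh_ne : ∀ t ∈ K, h t ≠ 0)
    (hf_eq : ∀ t ∈ K, deriv f t / f t = x t)
    (hφ_eq : ∀ t ∈ K, deriv φ t / φ t = k * x t)
    (hh_eq : ∀ t ∈ K, deriv h t / h t = x t * z t) :
    SemiRiemannian.IsQuasiEinsteinOn
      (𝓘(ℝ, EuclideanSpace ℝ (Fin n)).prod 𝓘(ℝ, EuclideanSpace ℝ (Fin m)))
      (SemiRiemannian.warpedMetric 𝓘(ℝ, EuclideanSpace ℝ (Fin n))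
        𝓘(ℝ, EuclideanSpace ℝ (Fin m))
        (SemiRiemannian.conformalMetric ε (fun p => φ (∑ i, α i * p i)))
        (fun p => f (∑ i, α i * p i)) gF)
      (fun q : EuclideanSpace ℝ (Fin n) × F => h (∑ i, α i * q.1 i)) r 0
      {q : EuclideanSpace ℝ (Fin n) × F | (∑ i, α i * q.1 i) ∈ K} := by

  have hr0 : (r : ℝ) ≠ 0 := by positivity
  have hode := fun t ht => SemiRiemannian.hasDerivAt_of_vFun_equation (t := t) hr0 hc.ne' hJ hV
    hKo hKc hz hzJ hz_nonconst hz_eq hx_eq ht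
  -- Each prescribed logarithmic derivative is turned into a linear equation u' = y u, the form
  -- needed for bootstrapping.
  have hlin : ∀ {u y : ℝ → ℝ}, DifferentiableOn ℝ u K → (∀ t ∈ K, u t ≠ 0) →
      (∀ t ∈ K, deriv u t / u t = y t) → ∀ t ∈ K, HasDerivAt u (y t * u t) t := by
    intro u y hu hu0 h t ht
    rw [← h t ht, div_mul_cancel₀ _ (hu0 t ht)]
    exact (hu.differentiableAt (hKo.mem_nhds ht)).hasDerivAt
  have hf0 : ∀ t ∈ K, f t ≠ 0 := fun t ht => (hf_pos t ht).ne'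
  simp only [← SemiRiemannian.coordForm_apply]
  exact SemiRiemannian.isQuasiEinsteinOn_warpedMetric_conformalMetric hε hgF hRic
    (SemiRiemannian.pseudoEuclideanForm_gradient hε α) hr0
    (by rwa [finrank_euclideanSpace_fin]) (by rwa [finrank_euclideanSpace_fin]) hKo hz
    (fun t ht => (hode t ht).1) (fun t ht => (hode t ht).2) (hlin hf hf0 hf_eq) hf0
    (hlin hφ hφ_ne hφ_eq) hφ_ne (hlin hh hh_ne hh_eq) hh_ne
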